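/- **Conventions.** Let $k$ be a field and $x_1>x_2>\dots>x_n$ variables with positive degrees $d_1,\dots,d_n$ in a linearly ordered abelian group $D$; the degree $D(u)$ of a word $u$ is the sum of the degrees of its letters. Words are compared lexicographically, a proper beginning of a word being greater than the word. A nonempty word $u$ is *standard* if $vw>wv$ whenever $u=vw$ with $v,w$ nonempty. *Standard nonassociative words* are the letters $x_i$ and those $[[v][w]]$ such that $[v],[w]$ are standard nonassociative, the words $v>w$ are standard, and $v_2\le w$ in case $[v]=[[v_1][v_2]]$. **Lie algebra.** Let $f=\sum_s\alpha_s[w_s]$ be a finite linear combination over $k$ of standard nonassociative words and let $\mathfrak g$ be the Lie algebra over $k$ with generators $x_1,\dots,x_n$ and the only defining relation $f=0$. The *Hall–Shirshov basis* of $\mathfrak g$ is the set of those standard nonassociative words $[u]$ whose value in $\mathfrak g$ is not a linear combination of the values of standard nonassociative words $[v]$ with $D(v)<D(u)$, or $D(v)=D(u)$ and $v<u$. **Quantification.** Let $G$ be an abelian group, $g_i\in G$, and $\chi^i:G\to k^{*}$ characters; put $p_{ij}=\chi^i(g_j)$, and for words $u,v$ let $g_u,\chi^u$ be the corresponding products over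 the letters and $p_{uv}=\chi^u(g_v)$. The *super-letter* of a standard nonassociative word $[u]$ is the polynomial in $k\langle x_1,\dots,x_n\rangle$ obtained by reading the brackets as $[u,v]=uv-p_{uv}vu$. Let $f^*$ be obtained from $f$ by this reading. Assume that $f$ admits a quantification, that is: all words $w_s$ with $\alpha_s\ne0$ have the same $g_{w_s}$ and the same $\chi^{w_s}$, and $f^*$ is a quantum operation (in every Hopf algebra over $k$ with a homomorphism from $G$ to its group-like elements, the value of $f^*$ is skew primitive whenever the $x_i$ take values $a_i$ with $\Delta(a_i)=a_i\otimes1+g_i\otimes a_i$ and $g^{-1}a_ig=\chi^i(g)a_i$ for all $g\in G$). Let $U_P(\mathfrak g)=\bigl(k\langle x_1,\dots,x_n\rangle/(f^*)\bigr)*G$ be the skew group algebra with $g^{-1}x_ig=\chi^i(g)x_i$. A *super-word* is a product of super-letters, a *$G$-super-word* is an element of $G$ times a super-word, and degrees are added. Super-letters are ordered as the standard words that define them. The super-letter $[u]$ is *hard* in $U_P(\mathfrak g)$ if its value there is not a linear combination of values of super-words of degree $D(u)$ in super-letters less than $[u]$ and of $G$-super-words of degree less than $D(u)$. **Corollary 8.1.**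 The set of all hard super-letters of $U_P(\mathfrak g)$ coincides with the Hall–Shirshov basis of $\mathfrak g$ with the skew commutator in place of the Lie operation: a standard nonassociative word defines a hard super-letter if and only if it belongs to the Hall–Shirshov basis of $\mathfrak g$. In particular, the set of standard nonassociative words that define hard super-letters does not depend on the parameters $p_{ij}$: it is the same for any two choices of $G$, $g_i$, $\chi^i$ that admit a quantification of $f$ (with the same $k$, $f$, order and degrees of the variables). -/

import Mathlib

open scoped TensorProduct

namespace SuperLetters

universe u v w

/-! ### Words in `x_1 > x_2 > ⋯ > x_n` and standard nonassociative words

The letter `x_{i+1}` is `i : Fin n`; a word is a list of letters; a nonassociative word is an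
element of the free magma. -/

/-- `u < v` in the lexicographic order of words in `x_1 > ⋯ > x_n`, where a proper beginning of a
word is greater than the word itself.  Both conventions are opposite to those of the order of
`List (Fin n)` (letters `0 < 1 < ⋯`, a proper beginning is smaller), hence the swap. -/
def WordLT {n : ℕ} (u v : List (Fin n)) : Prop := v < u

/-- A nonempty word `u` is standard if `vw > wv` whenever `u = vw` with `v, w` nonempty. -/
def IsStandardWord {n : ℕ} (u : List (Fin n)) : Prop :=
  u ≠ [] ∧ ∀ v w : List (Fin n), v ≠ [] → w ≠ [] → u = v ++ w → WordLT (w ++ v) (v ++ w)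

/-- The word obtained from a nonassociative word by erasing the brackets. -/
def word {n : ℕ} : FreeMagma (Fin n) → List (Fin n)
  | .of i => [i]
  | .mul a b => word a ++ word b

/-- Standard nonassociative words: the letters, and the words `[[v][w]]` with `[v]`, `[w]` standard
nonassociative, `v > w` standard, and `v₂ ≤ w` in case `[v] = [[v₁][v₂]]`. -/
def IsStandard {n : ℕ} : FreeMagma (Fin n) → Prop
  | .of _ => True
  | .mul a b => IsStandard a ∧ IsStandard b ∧ IsStandardWord (word a) ∧ IsStandardWord (word b) ∧
      WordLT (word b) (word a) ∧
      ∀ a₁ a₂, a = a₁ * a₂ → (WordLT (word a₂) (word b) ∨ word a₂ = word b)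

/-- The degree of a word, where the letter `x_i` has degree `d i`. -/
def degree {n : ℕ} {D : Type w} [AddCommGroup D] (d : Fin n → D) (u : List (Fin n)) : D :=
  (u.map d).sum

/-! ### The Lie algebra with one defining relation and its Hall–Shirshov basis -/

/-- The value of a nonassociative word in a Lie algebra at `x_i = a i`. -/
def lieValue {n : ℕ} {L : Type w} [LieRing L] (a : Fin n → L) : FreeMagma (Fin n) → L
  | .of i => a i
  | .mul s t => ⁅lieValue a s, lieValue a t⁆

/-- A linear combination `f` of nonassociative words, read in the free Lie algebra. -/
noncomputable def lieRelator {k : Type u} [Field k] {n : ℕ} (f : FreeMagma (Fin n) →₀ k) :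
    FreeLieAlgebra k (Fin n) :=
  f.sum fun t c => c • lieValue (FreeLieAlgebra.of k) t

/-- The Lie algebra given by the generators `x_1, …, x_n` and the only relation `f = 0`. -/
abbrev OneRelatorLie {k : Type u} [Field k] {n : ℕ} (f : FreeMagma (Fin n) →₀ k) : Type u :=
  FreeLieAlgebra k (Fin n) ⧸ LieSubmodule.lieSpan k (FreeLieAlgebra k (Fin n)) {lieRelator f}

/-- The generators `x_i` of `OneRelatorLie f`. -/
noncomputable def OneRelatorLie.gen {k : Type u} [Field k] {n : ℕ} (f : FreeMagma (Fin n) →₀ k)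
    (i : Fin n) : OneRelatorLie f :=
  LieSubmodule.Quotient.mk (FreeLieAlgebra.of k i)

/-- The Hall–Shirshov basis of a Lie algebra `L` generated by `a 1, …, a n`: the standard
nonassociative words whose value in `L` is not a linear combination of the values of lesser standard
nonassociative words, compared first by degree and then lexicographically. -/
def hallShirshovBasis (k : Type u) [Field k] {n : ℕ} {D : Type*} [AddCommGroup D] [LinearOrder D]
    (d : Fin n → D) {L : Type w} [LieRing L] [LieAlgebra k L] (a : Fin n → L) :
    Set (FreeMagma (Fin n)) :=
  {t | IsStandard t ∧ lieValue a t ∉ Submodule.span k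
    {z | ∃ s, IsStandard s ∧
      (degree d (word s) < degree d (word t) ∨
        (degree d (word s) = degree d (word t) ∧ WordLT (word s) (word t))) ∧
      z = lieValue a s}}

/-! ### Quantum variables and super-letters -/

/-- An element `g_i ∈ G` and a character `χ^i` of `G` are associated with every variable `x_i`. -/
structure QuantumVariables (k : Type u) [Field k] (n : ℕ) (G : Type v) [CommGroup G] where
  g : Fin n → G
  χ : Fin n → G →* kˣ

namespace QuantumVariables

variable {k : Type u} [Field k] {n : ℕ} {G : Type v} [CommGroup G]

/-- `g_u`: replace every `x_i` in the word `u` with `g_i`. -/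
def gr (Q : QuantumVariables k n G) (u : List (Fin n)) : G := (u.map Q.g).prod

/-- `χ^u` (as a function on `G`): replace every `x_i` in the word `u` with `χ^i`. -/
def chr (Q : QuantumVariables k n G) (u : List (Fin n)) (x : G) : kˣ := (u.map fun i => Q.χ i x).prod

/-- `p(u, v) = χ^u(g_v)`; on letters this is the quantification matrix `p_ij = χ^i(g_j)`. -/
def p (Q : QuantumVariables k n G) (u v : List (Fin n)) : kˣ := Q.chr u (Q.gr v)

/-- The polynomial obtained from a nonassociative word when the brackets mean the skew commutator
`[u, v] = uv - p(u, v) vu`.  It is called a super-letter if the word is standard. -/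
noncomputable def superLetter (Q : QuantumVariables k n G) :
    FreeMagma (Fin n) → FreeAlgebra k (Fin n)
  | .of i => FreeAlgebra.ι k i
  | .mul a b => superLetter Q a * superLetter Q b -
      (Q.p (word a) (word b) : k) • (superLetter Q b * superLetter Q a)

/-- `f^*`: the linear combination `f` of nonassociative words, where the Lie operation is replaced
with the skew commutator. -/
noncomputable def star (Q : QuantumVariables k n G) (f : FreeMagma (Fin n) →₀ k) :
    FreeAlgebra k (Fin n) :=
  f.sum fun t c => c • Q.superLetter t

/-- All the words of `f` have the same `G × G^*`-degree. -/
def IsHomogeneous (Q : QuantumVariables k n G) (f : FreeMagma (Fin n) →₀ k) : Prop :=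
  ∀ s ∈ f.support, ∀ t ∈ f.support,
    Q.gr (word s) = Q.gr (word t) ∧ Q.chr (word s) = Q.chr (word t)

end QuantumVariables

/-- Skew primitive elements of a Hopf algebra: `Δ(b) = b ⊗ h + g ⊗ b` with group-like `g, h`. -/
def IsSkewPrimitive (k : Type u) [Field k] {A : Type w} [Ring A] [HopfAlgebra k A] (b : A) : Prop :=
  ∃ g h : A, IsGroupLikeElem k g ∧ IsGroupLikeElem k h ∧
    Coalgebra.comul (R := k) b = b ⊗ₜ[k] h + g ⊗ₜ[k] b

namespace QuantumVariables

variable {k : Type u} [Field k] {n : ℕ} {G : Type v} [CommGroup G]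

/-- A polynomial `F` is a quantum operation if all of its values in all Hopf algebras are skew
primitive, provided that every variable `x_i` has a value `a i` with
`Δ(a_i) = a_i ⊗ 1 + g_i ⊗ a_i` and `g⁻¹ a_i g = χ^i(g) a_i` for `g ∈ G`. -/
def IsQuantumOperation (Q : QuantumVariables k n G) (F : FreeAlgebra k (Fin n)) : Prop :=
  ∀ (A : Type (max u v)) [Ring A] [HopfAlgebra k A] (γ : G →* A) (a : Fin n → A),
    (∀ x, IsGroupLikeElem k (γ x)) →
    (∀ i, Coalgebra.comul (R := k) (a i) = a i ⊗ₜ[k] 1 + γ (Q.g i) ⊗ₜ[k] a i) →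
    (∀ i x, γ x⁻¹ * a i * γ x = (Q.χ i x : k) • a i) →
    IsSkewPrimitive k (FreeAlgebra.lift k a F)

/-- The relation `f = 0` admits a quantification with the given quantum variables: `f^*` is
homogeneous (so that the algebra it defines is bigraded) and it is a quantum operation. -/
structure Quantifies (Q : QuantumVariables k n G) (f : FreeMagma (Fin n) →₀ k) : Prop where
  homogeneous : Q.IsHomogeneous f
  quantumOperation : Q.IsQuantumOperation (Q.star f)

/-! ### The quantum universal enveloping algebra -/

/-- The underlying algebra of `U_P^b(𝔤)`: generators `x_1, …, x_n`, the only relation `f^* = 0`.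
The proof of homogeneity is a parameter, since it is what makes `G` act on this algebra. -/
def BraidedEnv (Q : QuantumVariables k n G) (f : FreeMagma (Fin n) →₀ k)
    (_hf : Q.IsHomogeneous f) : Type u :=
  RingQuot fun a b : FreeAlgebra k (Fin n) => a = Q.star f ∧ b = 0

noncomputable instance (Q : QuantumVariables k n G) (f : FreeMagma (Fin n) →₀ k)
    (hf : Q.IsHomogeneous f) : Ring (Q.BraidedEnv f hf) :=
  inferInstanceAs (Ring (RingQuot fun a b : FreeAlgebra k (Fin n) => a = Q.star f ∧ b = 0))

noncomputable instance (Q : QuantumVariables k n G) (f : FreeMagma (Fin n) →₀ k)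
    (hf : Q.IsHomogeneous f) : Algebra k (Q.BraidedEnv f hf) :=
  inferInstanceAs (Algebra k (RingQuot fun a b : FreeAlgebra k (Fin n) => a = Q.star f ∧ b = 0))

/-- The projection of the free algebra onto `U_P^b(𝔤)`. -/
noncomputable def BraidedEnv.mk (Q : QuantumVariables k n G) (f : FreeMagma (Fin n) →₀ k)
    (hf : Q.IsHomogeneous f) : FreeAlgebra k (Fin n) →ₐ[k] Q.BraidedEnv f hf :=
  RingQuot.mkAlgHom k fun a b : FreeAlgebra k (Fin n) => a = Q.star f ∧ b = 0

theorem BraidedEnv.mk_star (Q : QuantumVariables k n G) (f : FreeMagma (Fin n) →₀ k)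
    (hf : Q.IsHomogeneous f) : BraidedEnv.mk Q f hf (Q.star f) = 0 := by
  have h := RingQuot.mkAlgHom_rel k
    (s := fun a b : FreeAlgebra k (Fin n) => a = Q.star f ∧ b = 0) (x := Q.star f) (y := 0)
    ⟨rfl, rfl⟩
  exact h.trans (map_zero _)

theorem BraidedEnv.hom_ext {Q : QuantumVariables k n G} {f : FreeMagma (Fin n) →₀ k}
    {hf : Q.IsHomogeneous f} {B : Type*} [Ring B] [Algebra k B]
    {φ ψ : Q.BraidedEnv f hf →ₐ[k] B}
    (h : ∀ i, φ (BraidedEnv.mk Q f hf (FreeAlgebra.ι k i)) =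
      ψ (BraidedEnv.mk Q f hf (FreeAlgebra.ι k i))) : φ = ψ := by
  refine RingQuot.ringQuot_ext' (S := k) (f := φ) (g := ψ) ?_
  exact FreeAlgebra.hom_ext (funext h)

/-- The action of `x ∈ G` on the free algebra, `x_i ↦ x x_i x⁻¹ = χ^i(x)⁻¹ x_i`. -/
noncomputable def twist (Q : QuantumVariables k n G) (x : G) :
    FreeAlgebra k (Fin n) →ₐ[k] FreeAlgebra k (Fin n) :=
  FreeAlgebra.lift k fun i => (((Q.χ i x)⁻¹ : kˣ) : k) • FreeAlgebra.ι k i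

theorem twist_superLetter (Q : QuantumVariables k n G) (x : G) (t : FreeMagma (Fin n)) :
    Q.twist x (Q.superLetter t) = (((Q.chr (word t) x)⁻¹ : kˣ) : k) • Q.superLetter t := by
  induction t using FreeMagma.rec with
  | of i => simp [superLetter, twist, chr, word]
  | mul a b iha ihb =>
    have hw : Q.chr (word (FreeMagma.mul a b)) x = Q.chr (word a) x * Q.chr (word b) x := by
      simp [word, chr]
    rw [hw, superLetter, map_sub, map_smul, map_mul, map_mul, iha, ihb]
    simp only [mul_inv, Units.val_mul, smul_mul_smul_comm, smul_sub]
    rw [smul_comm, mul_comm (((Q.chr (word b) x)⁻¹ : kˣ) : k)]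

theorem mk_twist_star (Q : QuantumVariables k n G) (f : FreeMagma (Fin n) →₀ k)
    (hf : Q.IsHomogeneous f) (x : G) : BraidedEnv.mk Q f hf (Q.twist x (Q.star f)) = 0 := by
  rcases f.support.eq_empty_or_nonempty with h0 | ⟨s, hs⟩
  · rw [Finsupp.support_eq_empty] at h0
    simp [star, h0]
  · have h : Q.twist x (Q.star f) = (((Q.chr (word s) x)⁻¹ : kˣ) : k) • Q.star f := by
      rw [star, Finsupp.sum, map_sum, Finset.smul_sum]
      refine Finset.sum_congr rfl fun t ht => ?_
      rw [map_smul, twist_superLetter, (hf t ht s hs).2, smul_comm]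
    rw [h, map_smul, BraidedEnv.mk_star, smul_zero]

/-- The action of `x ∈ G` on `U_P^b(𝔤)`. -/
noncomputable def BraidedEnv.act (Q : QuantumVariables k n G) (f : FreeMagma (Fin n) →₀ k)
    (hf : Q.IsHomogeneous f) (x : G) : Q.BraidedEnv f hf →ₐ[k] Q.BraidedEnv f hf :=
  RingQuot.liftAlgHom k ⟨(BraidedEnv.mk Q f hf).comp (Q.twist x), by
    rintro a b ⟨rfl, rfl⟩
    simpa using Q.mk_twist_star f hf x⟩

theorem BraidedEnv.act_mk (Q : QuantumVariables k n G) (f : FreeMagma (Fin n) →₀ k)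
    (hf : Q.IsHomogeneous f) (x : G) (a : FreeAlgebra k (Fin n)) :
    BraidedEnv.act Q f hf x (BraidedEnv.mk Q f hf a) = BraidedEnv.mk Q f hf (Q.twist x a) :=
  RingQuot.liftAlgHom_mkAlgHom_apply k ((BraidedEnv.mk Q f hf).comp (Q.twist x)) _ a

theorem BraidedEnv.act_one (Q : QuantumVariables k n G) (f : FreeMagma (Fin n) →₀ k)
    (hf : Q.IsHomogeneous f) : BraidedEnv.act Q f hf 1 = AlgHom.id k _ := by
  refine BraidedEnv.hom_ext fun i => ?_
  rw [BraidedEnv.act_mk]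
  simp [twist]

theorem BraidedEnv.act_mul (Q : QuantumVariables k n G) (f : FreeMagma (Fin n) →₀ k)
    (hf : Q.IsHomogeneous f) (x y : G) :
    BraidedEnv.act Q f hf (x * y) = (BraidedEnv.act Q f hf x).comp (BraidedEnv.act Q f hf y) := by
  refine BraidedEnv.hom_ext fun i => ?_
  rw [AlgHom.comp_apply, BraidedEnv.act_mk, BraidedEnv.act_mk, BraidedEnv.act_mk]
  simp [twist, smul_smul, mul_comm]

noncomputable instance (Q : QuantumVariables k n G) (f : FreeMagma (Fin n) →₀ k)
    (hf : Q.IsHomogeneous f) : MulSemiringAction G (Q.BraidedEnv f hf) where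
  smul x a := BraidedEnv.act Q f hf x a
  one_smul a := DFunLike.congr_fun (BraidedEnv.act_one Q f hf) a
  mul_smul x y a := DFunLike.congr_fun (BraidedEnv.act_mul Q f hf x y) a
  smul_zero x := map_zero (BraidedEnv.act Q f hf x)
  smul_add x := map_add (BraidedEnv.act Q f hf x)
  smul_one x := map_one (BraidedEnv.act Q f hf x)
  smul_mul x := map_mul (BraidedEnv.act Q f hf x)

theorem BraidedEnv.smul_def (Q : QuantumVariables k n G) (f : FreeMagma (Fin n) →₀ k)
    (hf : Q.IsHomogeneous f) (x : G) (a : Q.BraidedEnv f hf) :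
    x • a = BraidedEnv.act Q f hf x a := rfl

instance (Q : QuantumVariables k n G) (f : FreeMagma (Fin n) →₀ k)
    (hf : Q.IsHomogeneous f) : SMulCommClass G k (Q.BraidedEnv f hf) where
  smul_comm x c a := map_smul (BraidedEnv.act Q f hf x) c a

/-- The (underlying algebra of the) quantum universal enveloping algebra `U_P(𝔤)`: the skew group
algebra `U_P^b(𝔤) * G`, in which `x a = (x • a) x` for `x ∈ G`, `a ∈ U_P^b(𝔤)`. -/
abbrev QuantumEnv (Q : QuantumVariables k n G) (f : FreeMagma (Fin n) →₀ k)
    (hf : Q.IsHomogeneous f) : Type (max u v) :=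
  SkewMonoidAlgebra (Q.BraidedEnv f hf) G

/-- The elements of `G` in `U_P(𝔤)`. -/
noncomputable def QuantumEnv.ofGroup (Q : QuantumVariables k n G) (f : FreeMagma (Fin n) →₀ k)
    (hf : Q.IsHomogeneous f) : G →* Q.QuantumEnv f hf :=
  SkewMonoidAlgebra.of (Q.BraidedEnv f hf) G

/-- The generators `x_i` in `U_P(𝔤)`. -/
noncomputable def QuantumEnv.gen (Q : QuantumVariables k n G) (f : FreeMagma (Fin n) →₀ k)
    (hf : Q.IsHomogeneous f) (i : Fin n) : Q.QuantumEnv f hf :=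
  SkewMonoidAlgebra.single 1 (BraidedEnv.mk Q f hf (FreeAlgebra.ι k i))

/-- The commutation rule `g⁻¹ x_i g = χ^i(g) x_i`. -/
theorem QuantumEnv.conj_gen (Q : QuantumVariables k n G) (f : FreeMagma (Fin n) →₀ k)
    (hf : Q.IsHomogeneous f) (i : Fin n) (x : G) :
    QuantumEnv.ofGroup Q f hf x⁻¹ * QuantumEnv.gen Q f hf i * QuantumEnv.ofGroup Q f hf x =
      (Q.χ i x : k) • QuantumEnv.gen Q f hf i := by
  simp [QuantumEnv.ofGroup, QuantumEnv.gen, SkewMonoidAlgebra.of_apply,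
    SkewMonoidAlgebra.single_mul_single, BraidedEnv.smul_def, BraidedEnv.act_mk, twist,
    SkewMonoidAlgebra.smul_single]

/-! ### Hard super-letters -/

/-- The value of the super-letter of `t` in an algebra `H` at `x_i = a i`. -/
noncomputable def value (Q : QuantumVariables k n G) {H : Type w} [Ring H] [Algebra k H]
    (a : Fin n → H) (t : FreeMagma (Fin n)) : H :=
  FreeAlgebra.lift k a (Q.superLetter t)

/-- The value of a super-word, that is a word in super-letters. -/
noncomputable def superWordValue (Q : QuantumVariables k n G) {H : Type w} [Ring H] [Algebra k H]
    (a : Fin n → H) (l : List (FreeMagma (Fin n))) : H :=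
  (l.map (Q.value a)).prod

/-- The super-letter `[t]` is hard in an algebra `H` generated by `γ G` and `a 1, …, a n`: its value
is not a linear combination of values of super-words of the same degree in super-letters less than
`[t]` and of `G`-super-words (an element of `G` times a super-word) of a lesser degree. -/
def IsHard (Q : QuantumVariables k n G) {D : Type*} [AddCommGroup D] [LinearOrder D]
    (d : Fin n → D) {H : Type w} [Ring H] [Algebra k H] (γ : G →* H) (a : Fin n → H)
    (t : FreeMagma (Fin n)) : Prop :=
  Q.value a t ∉ Submodule.span k
    ({z | ∃ l : List (FreeMagma (Fin n)),
        (∀ s ∈ l, IsStandard s ∧ WordLT (word s) (word t)) ∧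
        (l.map fun s => degree d (word s)).sum = degree d (word t) ∧
        z = Q.superWordValue a l} ∪
     {z | ∃ (x : G) (l : List (FreeMagma (Fin n))),
        (∀ s ∈ l, IsStandard s) ∧
        (l.map fun s => degree d (word s)).sum < degree d (word t) ∧
        z = γ x * Q.superWordValue a l})

/-- The standard nonassociative words that define hard super-letters of `U_P(𝔤)`. -/
def hardWords (Q : QuantumVariables k n G) {D : Type*} [AddCommGroup D] [LinearOrder D]
    (d : Fin n → D) (f : FreeMagma (Fin n) →₀ k) (hf : Q.IsHomogeneous f) :
    Set (FreeMagma (Fin n)) :=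
  {t | IsStandard t ∧ Q.IsHard d (QuantumEnv.ofGroup Q f hf) (QuantumEnv.gen Q f hf) t}

/-- The set of all hard super-letters of `U_P(𝔤)`, as noncommutative polynomials. -/
def hardSuperLetters (Q : QuantumVariables k n G) {D : Type*} [AddCommGroup D] [LinearOrder D]
    (d : Fin n → D) (f : FreeMagma (Fin n) →₀ k) (hf : Q.IsHomogeneous f) :
    Set (FreeAlgebra k (Fin n)) :=
  {P | ∃ t, IsStandard t ∧ P = Q.superLetter t ∧
    Q.IsHard d (QuantumEnv.ofGroup Q f hf) (QuantumEnv.gen Q f hf) t}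

end QuantumVariables

end SuperLetters

namespace SuperLetters

universe u v w

/-! ### The lexicographic order -/

section Lex

variable {n : ℕ}

/-! Both sets have a description in which the quantification does not occur. Let `w` be the leading
word of `f`, by degree and then lexicographically. A standard nonassociative word lies in either set
exactly when `w` is not a factor of its word, and all of them do when `f = 0` (`mem_hardWords_iff`,
`mem_hallShirshovBasis_iff`).

Suppose `w` is a factor. A standard word properly containing `w` is a product `vl` of standard words
one of which contains `w` (`IsStandard.exists_split_of_infix`). By the (skew) Jacobi identity its
standard bracketing equals the (skew) commutator of those of `v` and `l` up to lesser terms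
(`exists_comm_sub_mem`, `exists_lie_sub_mem`). Induction on the length, starting from the relation
solved for its leading term, expresses the element through lesser ones (`value_mem_of_infix`,
`lieValue_mem_of_infix`). In the skew case homogeneity keeps the commutation factor the same for all
terms of top degree.

Suppose `w` is not a factor of the word of `t`. A super-letter is monic with its own word as leading
word, so a dependence of `[t]` on lesser terms gives an element of the ideal of `f^*` whose leading
word is that of `t`. A standard word does not overlap with itself, hence multiples of `f^*` with
equal leading words are congruent modulo lesser multiples, and the leading word of every nonzero
element of the ideal contains `w` (`multiple_sub_multiple_mem`, `eq_zero_of_mem_multiplesSpan`,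
`exists_infix_of_mk_eq`). The descent stops by Higman's lemma. Elements of `G` are removed by taking
the component of the unit; the Lie algebra is handled by mapping it to the associative algebra with
all `p_ij = 1`.

Inside proofs `<` on words is the order of lists, which is opposite to `WordLT`: lesser
super-letters have greater lists. -/

theorem lt_append_self (u : List (Fin n)) {v : List (Fin n)} (hv : v ≠ []) : u < u ++ v := by
  obtain ⟨a, v, rfl⟩ := List.exists_cons_of_ne_nil hv
  induction u with
  | nil => simp
  | cons b u ih => simpa [List.cons_lt_cons_iff] using ih

theorem le_append_self (u v : List (Fin n)) : u ≤ u ++ v := by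
  rcases eq_or_ne v [] with rfl | hv
  · simp
  · exact (lt_append_self u hv).le

theorem append_lt_append_left_iff (u : List (Fin n)) {v w : List (Fin n)} :
    u ++ v < u ++ w ↔ v < w := by
  induction u with
  | nil => simp
  | cons b u ih => simpa [List.cons_lt_cons_iff] using ih

/-- The comparison is decided at the first letter where the words differ, so continuations do not
affect it. -/
theorem append_lt_append_of_not_prefix {u v : List (Fin n)} (h : u < v) (hp : ¬ u <+: v)
    (x y : List (Fin n)) : u ++ x < v ++ y := by
  induction u generalizing v with
  | nil => simp at hp
  | cons b u ih =>
    cases v with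
    | nil => simp at h
    | cons c v =>
      simp only [List.cons_lt_cons_iff, List.cons_append, List.cons_prefix_cons, not_and] at h hp ⊢
      rcases h with h | ⟨rfl, h⟩
      · exact Or.inl h
      · exact Or.inr ⟨rfl, ih h (hp rfl)⟩

theorem append_lt_of_not_prefix {u v : List (Fin n)} (h : u < v) (hp : ¬ u <+: v)
    (x : List (Fin n)) : u ++ x < v := by
  simpa using append_lt_append_of_not_prefix h hp x []

theorem append_lt_append_right_of_length_eq {u v : List (Fin n)} (h : u < v)
    (hl : v.length ≤ u.length) (x y : List (Fin n)) : u ++ x < v ++ y :=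
  append_lt_append_of_not_prefix h (fun hp => h.ne (hp.eq_of_length_le hl)) x y

end Lex

/-! ### Standard words -/

section Standard

variable {n : ℕ}

/-- The definition compares a word with its cyclic shifts; comparison with proper ends, the usual
form of the Lyndon property, is what later arguments use. If an end `w` were less than `u` without
being a beginning of it, the shift starting with `w` would be less than `u` as well. -/
theorem isStandardWord_iff {u : List (Fin n)} : IsStandardWord u ↔
    u ≠ [] ∧ ∀ v w : List (Fin n), v ≠ [] → w ≠ [] → u = v ++ w → u < w := by
  refine and_congr_right fun _ => ⟨fun h v w hv hw e => ?_, fun h v w hv hw e => ?_⟩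
  · by_contra hlt
    have hlen : w.length < u.length := by
      have := List.length_pos_of_ne_nil hv
      simp [e]; omega
    have hlt : w < u := lt_of_le_of_ne (not_lt.1 hlt) (by rintro rfl; omega)
    have h1 : v ++ w < w ++ v := h v w hv hw e
    by_cases hp : w <+: u
    · obtain ⟨z, hz⟩ := hp
      have hz0 : z ≠ [] := by rintro rfl; simp at hz; subst hz; omega
      have h2 : w ++ z < z ++ w := h w z hw hz0 hz.symm
      rw [← e, ← hz, append_lt_append_left_iff] at h1
      have hl : v.length = z.length := by
        have := congrArg List.length (hz.trans e); simp at this; omega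
      have h3 : z ++ w < v ++ w := append_lt_append_right_of_length_eq h1 hl.le w w
      rw [← e, ← hz] at h3
      exact lt_asymm h2 h3
    · have := append_lt_of_not_prefix hlt hp v
      rw [← e] at h1
      exact lt_asymm h1 this
  · have := (h v w hv hw e).trans_le (le_append_self w v)
    rwa [e] at this

theorem IsStandardWord.ne_nil {u : List (Fin n)} (h : IsStandardWord u) : u ≠ [] := h.1

theorem IsStandardWord.lt_suffix {v w : List (Fin n)} (h : IsStandardWord (v ++ w)) (hv : v ≠ [])
    (hw : w ≠ []) : v ++ w < w := (isStandardWord_iff.1 h).2 v w hv hw rfl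

/-- A standard word is less than each of its proper ends also after prolongation. -/
theorem IsStandardWord.append_lt_suffix {v w : List (Fin n)} (h : IsStandardWord (v ++ w))
    (hv : v ≠ []) (hw : w ≠ []) (x y : List (Fin n)) : v ++ w ++ x < w ++ y :=
  append_lt_append_right_of_length_eq (h.lt_suffix hv hw) (by simp) x y

theorem isStandardWord_singleton (i : Fin n) : IsStandardWord [i] := by
  refine ⟨by simp, fun v w hv hw e => ?_⟩
  have := congrArg List.length e
  have := List.length_pos_of_ne_nil hv
  have := List.length_pos_of_ne_nil hw
  simp at *; omega

/-- If `u < v` and `v` is less than its proper ends, then `uv < v`. -/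
theorem IsStandardWord.append_lt_self {u v : List (Fin n)} (hv : IsStandardWord v) (hu : u ≠ [])
    (h : u < v) : u ++ v < v := by
  by_cases hp : u <+: v
  · obtain ⟨z, rfl⟩ := hp
    have hz : z ≠ [] := by rintro rfl; simp at h
    rw [append_lt_append_left_iff]
    exact hv.lt_suffix hu hz
  · exact append_lt_of_not_prefix h hp v

/-- An end of `uv` lying in `v` is at least `v`, which exceeds `uv`; a longer one begins with a
proper end of `u`, and that already exceeds `u` under any prolongation. -/
theorem IsStandardWord.append {u v : List (Fin n)} (hu : IsStandardWord u) (hv : IsStandardWord v)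
    (h : u < v) : IsStandardWord (u ++ v) := by
  refine isStandardWord_iff.2 ⟨by simp [hu.ne_nil], fun a b ha hb e => ?_⟩
  have huv := hv.append_lt_self hu.ne_nil h
  rcases List.append_eq_append_iff.1 e with ⟨c, rfl, rfl⟩ | ⟨c, rfl, rfl⟩
  · rcases eq_or_ne c [] with rfl | hc
    · simpa using huv
    · exact huv.trans (hv.lt_suffix hc hb)
  · rcases eq_or_ne c [] with rfl | hc
    · simpa using huv
    · exact hu.append_lt_suffix ha hc v v

/-- A nonempty word has a least nonempty end `l`. -/
theorem exists_min_suffix {b : List (Fin n)} (hb : b ≠ []) : ∃ c l, b = c ++ l ∧ l ≠ [] ∧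
    ∀ x y, y ≠ [] → b = x ++ y → l ≤ y := by
  induction b with
  | nil => exact absurd rfl hb
  | cons i b ih =>
    rcases eq_or_ne b [] with rfl | hb'
    · refine ⟨[], [i], rfl, by simp, fun x y hy e => ?_⟩
      rcases List.append_eq_singleton_iff.1 e.symm with ⟨_, rfl⟩ | ⟨_, rfl⟩
      · exact le_rfl
      · exact absurd rfl hy
    · obtain ⟨c, l, rfl, hl, h⟩ := ih hb'
      rcases le_total l (i :: (c ++ l)) with hle | hle
      · refine ⟨i :: c, l, rfl, hl, fun x y hy e => ?_⟩
        rcases List.cons_eq_append_iff.1 e with ⟨_, rfl⟩ | ⟨x', rfl, e'⟩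
        · exact hle
        · exact h x' y hy e'
      · refine ⟨[], i :: (c ++ l), rfl, by simp, fun x y hy e => ?_⟩
        rcases List.cons_eq_append_iff.1 e with ⟨_, rfl⟩ | ⟨x', rfl, e'⟩
        · exact le_rfl
        · exact hle.trans (h x' y hy e')

/-- The least nonempty end of a word is standard. -/
theorem isStandardWord_of_min_suffix {c l : List (Fin n)} (hl : l ≠ [])
    (h : ∀ x y, y ≠ [] → c ++ l = x ++ y → l ≤ y) : IsStandardWord l := by
  refine isStandardWord_iff.2 ⟨hl, fun v w hv hw e => lt_of_le_of_ne ?_ ?_⟩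
  · exact h (c ++ v) w hw (by simp [e])
  · rintro rfl
    exact hv (by simpa using e)

/-- A standard beginning `w` of a standard word `w ++ b` can be prolonged to a standard `v` such
that the rest of the word is standard. -/
theorem IsStandardWord.exists_split_of_prefix {w b : List (Fin n)} (hw : IsStandardWord w)
    (hb : b ≠ []) (hu : IsStandardWord (w ++ b)) :
    ∃ c l, b = c ++ l ∧ IsStandardWord (w ++ c) ∧ IsStandardWord l := by
  -- The second factor is the least nonempty end of `b`. What has to be shown is that `wc` is less
  -- than each of its proper ends `s`.
  obtain ⟨c, l, rfl, hl, hmin⟩ := exists_min_suffix hb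
  refine ⟨c, l, rfl, ?_, isStandardWord_of_min_suffix hl hmin⟩
  have hlstd := isStandardWord_of_min_suffix hl hmin
  refine isStandardWord_iff.2 ⟨by simp [hw.ne_nil], fun r s hr hs e => ?_⟩
  have hu' : IsStandardWord (r ++ (s ++ l)) := by
    rw [← List.append_assoc, ← e]; simpa using hu
  have hsl : r ++ (s ++ l) < s ++ l := hu'.lt_suffix hr (by simp [hs])
  have hlen := congrArg List.length e
  have hrpos := List.length_pos_of_ne_nil hr
  simp only [List.length_append] at hlen
  by_contra hlt
  have hlt : s < w ++ c := lt_of_le_of_ne (not_lt.1 hlt) (by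
    rintro rfl; exact hr (by simpa using e))
  by_cases hp : s <+: w ++ c
  · obtain ⟨v', hv'⟩ := hp
    have e1 : r ++ (s ++ l) = s ++ (v' ++ l) := by
      rw [← List.append_assoc, ← e, ← hv', List.append_assoc]
    have h1 : v' ++ l < l := by rwa [e1, append_lt_append_left_iff] at hsl
    -- If `w` were a beginning of `s`, then `v'l` would be an end of `b` less than the least one.
    have hsw : s.length < w.length := by
      by_contra hge
      have : w <+: s := List.prefix_of_prefix_length_le (List.prefix_append w c)
        ⟨v', hv'⟩ (not_lt.1 hge)
      obtain ⟨s', rfl⟩ := this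
      rw [List.append_assoc, List.append_cancel_left_eq] at hv'
      exact not_lt.2 (hmin s' (v' ++ l) (by simp [hl]) (by rw [← hv']; simp)) h1
    have hsp : s <+: w := List.prefix_of_prefix_length_le ⟨v', hv'⟩ (List.prefix_append w c) hsw.le
    have hsltw : s < w := by
      obtain ⟨z, rfl⟩ := hsp
      exact lt_append_self s (by rintro rfl; simp at hsw)
    -- If `s` lies inside `c`, then `s < w ≤ u < l` gives `sl < l`, although `sl` is an end of `b`.
    -- Otherwise `s` starts with a proper end of `w`, which exceeds `w`, against `s < w`.
    rcases List.append_eq_append_iff.1 e with ⟨d, rfl, rfl⟩ | ⟨d, rfl, rfl⟩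
    · -- `s` is an end of `c`
      have hle : l ≤ s ++ l := hmin d (s ++ l) (by simp [hs]) (by simp)
      have hslt : s < l := by
        refine hsltw.trans_le ?_
        refine (le_append_self w (d ++ s ++ l)).trans (le_of_lt ?_)
        have : IsStandardWord ((w ++ (d ++ s)) ++ l) := by simpa using hu
        simpa using this.lt_suffix (by simp [hw.ne_nil]) hl
      exact not_lt.2 hle (hlstd.append_lt_self hs hslt)
    · rcases eq_or_ne d [] with rfl | hd
      · have hle : l ≤ c ++ l := hmin [] (c ++ l) (by simp [hl]) (by simp)
        have hslt : c < l := by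
          simp only [List.nil_append, List.append_nil] at *
          refine hsltw.trans_le ?_
          refine (le_append_self r (c ++ l)).trans (le_of_lt ?_)
          have : IsStandardWord ((r ++ c) ++ l) := by simpa using hu
          simpa using this.lt_suffix (by simp [hr]) hl
        simp only [List.nil_append] at *
        exact not_lt.2 hle (hlstd.append_lt_self hs hslt)
      · have h2 := hw.lt_suffix hr hd
        exact lt_asymm hsltw (h2.trans_le (le_append_self d c))
  · have h2 := append_lt_append_of_not_prefix hlt hp l l
    rw [e, List.append_assoc] at h2
    exact lt_asymm hsl h2

/-- Two occurrences of a standard word do not overlap. -/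
theorem IsStandardWord.occurrences {w a b a' b' : List (Fin n)} (hw : IsStandardWord w)
    (e : a ++ w ++ b = a' ++ w ++ b') (hl : a.length ≤ a'.length) :
    (a = a' ∧ b = b') ∨ ∃ c, a' = a ++ w ++ c ∧ b = c ++ w ++ b' := by
  simp only [List.append_assoc] at e
  rcases List.append_eq_append_iff.1 e with ⟨c, rfl, e1⟩ | ⟨c, rfl, e1⟩
  · rcases eq_or_ne c [] with rfl | hc
    · left; simpa using e1
    · right
      rcases List.append_eq_append_iff.1 e1 with ⟨d, rfl, e2⟩ | ⟨d, e3, e2⟩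
      · exact ⟨d, by simp, by simpa using e2⟩
      · rcases eq_or_ne d [] with rfl | hd
        · refine ⟨[], by simp at e3; simp [e3], by simp at e2; simp [e2]⟩
        -- The overlap `d` is a proper end of `w`, so `w < d`, and also a beginning of `w`, so `d ≤
        -- w`.
        · exfalso
          have h1 : w < d := by
            rw [e3] at hw ⊢; exact hw.lt_suffix hc hd
          have hd' : d <+: w := by
            refine List.prefix_of_prefix_length_le ⟨b, e2.symm⟩ (List.prefix_append w b') ?_
            rw [e3]; simp
          obtain ⟨z, rfl⟩ := hd'
          exact not_lt.2 (le_append_self d z) h1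
  · simp only [List.length_append] at hl
    have : c = [] := by
      cases c with
      | nil => rfl
      | cons => simp at hl
    subst this
    left; simp at e1; simp [e1]

end Standard

/-! ### Standard nonassociative words -/

section Tree

variable {n : ℕ}

@[simp] theorem word_of (i : Fin n) : word (FreeMagma.of i) = [i] := rfl

@[simp] theorem word_mul (a b : FreeMagma (Fin n)) : word (a * b) = word a ++ word b := rfl

theorem IsStandard.isStandardWord {t : FreeMagma (Fin n)} (h : IsStandard t) :
    IsStandardWord (word t) := by
  cases t with
  | of i => exact isStandardWord_singleton i
  | mul a b => exact h.2.2.1.append h.2.2.2.1 h.2.2.2.2.1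

theorem word_ne_nil (t : FreeMagma (Fin n)) : word t ≠ [] := by
  induction t using FreeMagma.rec with
  | of i => simp [word]
  | mul a b iha ihb => simp [word, iha]

/-- In a standard nonassociative word `[[a][b]]`, the word `b` is the least proper end. -/
theorem IsStandard.le_suffix {a b : FreeMagma (Fin n)} (h : IsStandard (a * b))
    {x y : List (Fin n)} (hx : x ≠ []) (hy : y ≠ []) (e : word a ++ word b = x ++ y) :
    word b ≤ y := by
  induction a using FreeMagma.rec generalizing b x y with
  | of i =>
    rcases List.append_eq_append_iff.1 e with ⟨c, rfl, e1⟩ | ⟨c, e1, rfl⟩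
    · rcases eq_or_ne c [] with rfl | hc
      · simp [e1]
      · have := h.2.2.2.1
        rw [e1] at this ⊢
        exact (this.lt_suffix hc hy).le
    · rcases List.append_eq_singleton_iff.1 e1.symm with ⟨rfl, _⟩ | ⟨_, rfl⟩
      · exact absurd rfl hx
      · simp
  | mul a₁ a₂ ih =>
    rcases List.append_eq_append_iff.1 e with ⟨c, rfl, e1⟩ | ⟨c, e1, rfl⟩
    · rcases eq_or_ne c [] with rfl | hc
      · simp [e1]
      · have := h.2.2.2.1
        rw [e1] at this ⊢
        exact (this.lt_suffix hc hy).le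
    · rcases eq_or_ne c [] with rfl | hc
      · simp
      · have h2 : word a₂ ≤ c := ih h.1 hx hc e1
        have h3 : word b ≤ word a₂ := by
          rcases h.2.2.2.2.2 a₁ a₂ rfl with h | h
          · exact le_of_lt h
          · exact h.ge
        exact (h3.trans h2).trans (le_append_self _ _)

/-- The bracketing of a standard nonassociative word is determined by the word. -/
theorem IsStandard.eq_of_word_eq {s t : FreeMagma (Fin n)} (hs : IsStandard s)
    (ht : IsStandard t) (h : word s = word t) : s = t := by
  induction s using FreeMagma.rec generalizing t with
  | of i =>
    cases t with
    | of j => rw [show i = j by simpa [word] using h]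
    | mul a b =>
      have := congrArg List.length h
      have := List.length_pos_of_ne_nil (word_ne_nil a)
      have := List.length_pos_of_ne_nil (word_ne_nil b)
      simp [word] at *; omega
  | mul a b iha ihb =>
    cases t with
    | of j =>
      have := congrArg List.length h
      have := List.length_pos_of_ne_nil (word_ne_nil a)
      have := List.length_pos_of_ne_nil (word_ne_nil b)
      simp [word] at *; omega
    | mul a' b' =>
      have h : word a ++ word b = word a' ++ word b' := h
      have h1 : word b ≤ word b' := hs.le_suffix (word_ne_nil _) (word_ne_nil _) h
      have h2 : word b' ≤ word b := ht.le_suffix (word_ne_nil _) (word_ne_nil _) h.symm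
      have hb := le_antisymm h1 h2
      rw [hb, List.append_cancel_right_eq] at h
      rw [iha hs.1 ht.1 h, ihb hs.2.1 ht.2.1 hb]

/-- The product of standard nonassociative words, when it is standard. -/
theorem IsStandard.mul {a b : FreeMagma (Fin n)} (ha : IsStandard a) (hb : IsStandard b)
    (h : word a < word b) (h' : ∀ a₁ a₂, a = a₁ * a₂ → word b ≤ word a₂) : IsStandard (a * b) :=
  ⟨ha, hb, ha.isStandardWord, hb.isStandardWord, h, fun a₁ a₂ e => (h' a₁ a₂ e).lt_or_eq.imp id Eq.symm⟩

/-- For standard `[a]`, `[b]` with `a < b` in the order of lists, either `[[a][b]]` is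
standard or `[a] = [[a₁][a₂]]` with `a₂ < b`. -/
theorem IsStandard.mul_or {a b : FreeMagma (Fin n)} (ha : IsStandard a) (hb : IsStandard b)
    (h : word a < word b) :
    IsStandard (a * b) ∨ ∃ a₁ a₂, a = a₁ * a₂ ∧ word a₂ < word b := by
  by_cases h' : ∃ a₁ a₂, a = a₁ * a₂ ∧ word a₂ < word b
  · exact Or.inr h'
  · push Not at h'
    exact Or.inl (ha.mul hb h h')

/-- Standard bracketings exist for products. -/
theorem IsStandard.exists_word_append {a b : FreeMagma (Fin n)} (ha : IsStandard a)
    (hb : IsStandard b) (h : word a < word b) :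
    ∃ t, IsStandard t ∧ word t = word a ++ word b := by
  induction a using FreeMagma.rec generalizing b with
  | of i => exact ⟨_, ha.mul hb h (by rintro a₁ a₂ ⟨⟩), rfl⟩
  | mul a₁ a₂ ih₁ ih₂ =>
    rcases IsStandard.mul_or ha hb h with h' | ⟨b₁, b₂, e, h'⟩
    · exact ⟨_, h', rfl⟩
    · cases e
      -- The brackets are moved to the right: the word is read as `a₁` times the word `a₂b`, both
      -- having standard bracketings.
      obtain ⟨t₂, ht₂, e₂⟩ := ih₂ ha.2.1 hb h'
      obtain ⟨t, ht, e⟩ := ih₁ ha.1 ht₂ (by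
        rw [e₂]; exact lt_of_lt_of_le ha.2.2.2.2.1 (le_append_self _ _))
      exact ⟨t, ht, by rw [e, e₂]; simp [word]⟩

/-- Prolonging the first letter to a standard beginning with standard remainder splits the word into
two shorter standard words, to which induction applies. -/
theorem IsStandardWord.exists_isStandard {u : List (Fin n)} (hu : IsStandardWord u) :
    ∃ t, IsStandard t ∧ word t = u := by
  induction hl : u.length using Nat.strong_induction_on generalizing u with
  | _ N ih =>
    obtain ⟨i, b, rfl⟩ := List.exists_cons_of_ne_nil hu.ne_nil
    rcases eq_or_ne b [] with rfl | hb
    · exact ⟨FreeMagma.of i, trivial, rfl⟩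
    · obtain ⟨c, l, rfl, hc, hl'⟩ :=
        (isStandardWord_singleton i).exists_split_of_prefix hb (by simpa using hu)
      simp only [List.length_cons, List.length_append] at hl
      have := List.length_pos_of_ne_nil hl'.ne_nil
      obtain ⟨s, hs, es⟩ := ih _ (by simp; omega) hc rfl
      obtain ⟨t, ht, et⟩ := ih _ (by omega) hl' rfl
      have hlt : word s < word t := by
        rw [es, et]
        refine (le_append_self _ l).trans_lt ?_
        have : IsStandardWord (([i] ++ c) ++ l) := by simpa using hu
        exact this.lt_suffix (by simp) hl'.ne_nil
      obtain ⟨r, hr, er⟩ := hs.exists_word_append ht hlt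
      exact ⟨r, hr, by rw [er, es, et]; simp⟩

/-- A standard proper factor of a standard word `u` is a factor of `v` or of `l` for some
decomposition `u = vl` into standard words. -/
theorem IsStandard.exists_split_of_infix {t : FreeMagma (Fin n)} (ht : IsStandard t)
    {w : List (Fin n)} (hw : IsStandardWord w) (hwt : w <:+: word t) (hne : w ≠ word t) :
    ∃ a b, IsStandard a ∧ IsStandard b ∧ word t = word a ++ word b ∧ word a < word b ∧
      (w <:+: word a ∨ w <:+: word b) := by
  cases t with
  | of i =>
    obtain ⟨x, y, e⟩ := hwt
    have := congrArg List.length e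
    have := List.length_pos_of_ne_nil hw.ne_nil
    simp only [word, List.length_append, List.length_singleton] at *
    have hx : x = [] := List.length_eq_zero_iff.1 (by omega)
    have hy : y = [] := List.length_eq_zero_iff.1 (by omega)
    subst hx hy
    simp at e
    exact absurd e hne
  | mul a b =>
    by_cases h1 : w <:+: word a
    · exact ⟨a, b, ht.1, ht.2.1, rfl, ht.2.2.2.2.1, Or.inl h1⟩
    by_cases h2 : w <:+: word b
    · exact ⟨a, b, ht.1, ht.2.1, rfl, ht.2.2.2.2.1, Or.inr h2⟩
    obtain ⟨x, y, e⟩ := hwt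
    have e' : x ++ (w ++ y) = word a ++ word b := by rw [← List.append_assoc]; exact e
    -- An occurrence `w = w₁w₂` across the boundary of the standard factorization must start at the
    -- beginning of the word. Otherwise minimality of the end `b` gives `b ≤ w₁b = wy`, while `wy <
    -- w₂y = b` because `w` is standard.
    have hx : x = [] := by
      by_contra hx
      rcases List.append_eq_append_iff.1 e' with ⟨w₁, ea, e1⟩ | ⟨c, rfl, e1⟩
      · rcases List.append_eq_append_iff.1 e1 with ⟨d, rfl, _⟩ | ⟨w₂, rfl, eb⟩
        · exact h1 ⟨x, d, by simp [ea]⟩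
        · rcases eq_or_ne w₁ [] with rfl | hw₁
          · exact h2 ⟨[], y, by simp [eb]⟩
          rcases eq_or_ne w₂ [] with rfl | hw₂
          · exact h1 ⟨x, [], by simp [ea]⟩
          have h3 := ht.le_suffix hx (y := w₁ ++ word b) (by simp [hw₁]) (by simp [ea])
          rw [eb, ← List.append_assoc] at h3
          exact not_lt.2 h3 (hw.append_lt_suffix hw₁ hw₂ y y)
      · exact h2 ⟨c, y, by simp [e1]⟩
    subst hx
    have hy : y ≠ [] := by rintro rfl; simp at e; exact hne e
    have hstd := ht.isStandardWord
    rw [← e, List.nil_append] at hstd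
    -- Now `w` is a proper beginning, and the standard factorization is replaced with one whose
    -- first factor starts with `w`.
    obtain ⟨c, l, rfl, hc, hl⟩ := hw.exists_split_of_prefix hy hstd
    obtain ⟨s, hs, es⟩ := hc.exists_isStandard
    obtain ⟨r, hr, er⟩ := hl.exists_isStandard
    refine ⟨s, r, hs, hr, by rw [← e, es, er]; simp, ?_, Or.inl ⟨[], c, by simp [es]⟩⟩
    rw [es, er]
    refine (le_append_self _ l).trans_lt ?_
    rw [← List.append_assoc] at hstd
    exact hstd.lt_suffix (by simp [hw.ne_nil]) hl.ne_nil

/-- The inequalities used to rewrite `[[[a₁][a₂]][b]]`. -/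
theorem IsStandard.lt_of_mul {a₁ a₂ b : FreeMagma (Fin n)} (ha : IsStandard (a₁ * a₂))
    (hb : IsStandard b) (h : word a₂ < word b) :
    word a₁ ++ word a₂ ++ word b < word a₂ ∧
      word a₁ ++ word a₂ ++ word b < word a₁ ++ word b := by
  constructor
  · simpa using ha.isStandardWord.append_lt_suffix (word_ne_nil a₁) (word_ne_nil a₂) (word b) []
  · rw [List.append_assoc, append_lt_append_left_iff]
    exact hb.isStandardWord.append_lt_self (word_ne_nil _) h

end Tree
-- Degrees of words
section Degree

variable {n : ℕ} {D : Type w} [AddCommGroup D] (d : Fin n → D)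

theorem degree_append (u v : List (Fin n)) : degree d (u ++ v) = degree d u + degree d v := by
  simp [degree]

theorem degree_perm {u v : List (Fin n)} (h : u.Perm v) : degree d u = degree d v :=
  (h.map d).sum_eq

theorem degree_flatMap_word (l : List (FreeMagma (Fin n))) :
    degree d (l.flatMap word) = (l.map fun s => degree d (word s)).sum := by
  induction l with
  | nil => simp [degree]
  | cons s l ih => simp [degree_append, ih]

variable [LinearOrder D] [IsOrderedAddMonoid D] {d}

theorem degree_nonneg (hd : ∀ i, 0 < d i) (u : List (Fin n)) : 0 ≤ degree d u :=
  List.sum_nonneg (by simpa using fun i _ => (hd i).le)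

theorem degree_pos (hd : ∀ i, 0 < d i) {u : List (Fin n)} (hu : u ≠ []) : 0 < degree d u := by
  obtain ⟨i, v, rfl⟩ := List.exists_cons_of_ne_nil hu
  have := degree_nonneg hd v
  simp only [degree, List.map_cons, List.sum_cons] at *
  exact add_pos_of_pos_of_nonneg (hd i) this

/-- A word of no greater degree than `u` that is different from `u` does not begin with `u`. -/
theorem not_prefix_of_degree_le (hd : ∀ i, 0 < d i) {u v : List (Fin n)} (h : u < v)
    (h' : degree d v ≤ degree d u) : ¬ u <+: v := by
  rintro ⟨z, rfl⟩
  have hz : z ≠ [] := by rintro rfl; simp at h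
  have := degree_pos hd hz
  rw [degree_append] at h'
  exact absurd h' (not_le.2 (lt_add_of_pos_right _ this))

theorem degree_le_of_mem (hd : ∀ i, 0 < d i) {l : List (FreeMagma (Fin n))} {s} (hs : s ∈ l) :
    degree d (word s) ≤ degree d (l.flatMap word) := by
  obtain ⟨l₁, l₂, rfl⟩ := List.append_of_mem hs
  have h1 := degree_nonneg hd (l₁.flatMap word)
  have h2 := degree_nonneg hd (l₂.flatMap word)
  simp only [List.flatMap_append, List.flatMap_cons, degree_append]
  exact (le_add_of_nonneg_right h2).trans (le_add_of_nonneg_left h1)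

end Degree

/-! ### Skew commutators of super-letters -/

namespace QuantumVariables

variable {k : Type u} [Field k] {n : ℕ} {G : Type v} [CommGroup G] (Q : QuantumVariables k n G)

theorem gr_append (u v : List (Fin n)) : Q.gr (u ++ v) = Q.gr u * Q.gr v := by simp [gr]

theorem chr_append (u v : List (Fin n)) : Q.chr (u ++ v) = Q.chr u * Q.chr v := by
  ext x; simp [chr]

theorem chr_apply_one (u : List (Fin n)) : Q.chr u 1 = 1 := by
  induction u with
  | nil => simp [chr]
  | cons i u ih => simp [chr]

theorem chr_apply_mul (u : List (Fin n)) (x y : G) : Q.chr u (x * y) = Q.chr u x * Q.chr u y := by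
  simp [chr]

theorem gr_perm {u v : List (Fin n)} (h : u.Perm v) : Q.gr u = Q.gr v := (h.map Q.g).prod_eq

theorem chr_perm {u v : List (Fin n)} (h : u.Perm v) : Q.chr u = Q.chr v :=
  funext fun _ => (h.map _).prod_eq

theorem p_append_left (u v w : List (Fin n)) : Q.p (u ++ v) w = Q.p u w * Q.p v w := by
  simp [p, chr_append]

theorem p_append_right (u v w : List (Fin n)) : Q.p u (v ++ w) = Q.p u v * Q.p u w := by
  simp [p, gr_append, chr_apply_mul]

theorem p_nil_right (u : List (Fin n)) : Q.p u [] = 1 := by simp [p, gr, chr_apply_one]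

variable {H : Type w} [Ring H] [Algebra k H] (x : Fin n → H)

theorem value_mul (s t : FreeMagma (Fin n)) : Q.value x (s * t) =
    Q.value x s * Q.value x t - (Q.p (word s) (word t) : k) • (Q.value x t * Q.value x s) := by
  change FreeAlgebra.lift k x (Q.superLetter (FreeMagma.mul s t)) = _
  simp [superLetter, value]

@[simp] theorem superWordValue_nil : Q.superWordValue x [] = 1 := by simp [superWordValue]

theorem superWordValue_cons (s : FreeMagma (Fin n)) (l : List (FreeMagma (Fin n))) :
    Q.superWordValue x (s :: l) = Q.value x s * Q.superWordValue x l := by simp [superWordValue]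

theorem superWordValue_append (l l' : List (FreeMagma (Fin n))) :
    Q.superWordValue x (l ++ l') = Q.superWordValue x l * Q.superWordValue x l' := by
  simp [superWordValue]

@[simp] theorem superWordValue_singleton (s : FreeMagma (Fin n)) :
    Q.superWordValue x [s] = Q.value x s := by simp [superWordValue]

/-- The span of the values of a set of super-words. -/
def superSpan (E : Set (List (FreeMagma (Fin n)))) : Submodule k H :=
  Submodule.span k (Q.superWordValue x '' E)

variable {x} {Q}

theorem superSpan_mono {E E' : Set (List (FreeMagma (Fin n)))} (h : E ⊆ E') :
    Q.superSpan x E ≤ Q.superSpan x E' :=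
  Submodule.span_mono (Set.image_mono h)

theorem superWordValue_mem {E : Set (List (FreeMagma (Fin n)))} {l} (h : l ∈ E) :
    Q.superWordValue x l ∈ Q.superSpan x E :=
  Submodule.subset_span ⟨l, h, rfl⟩

theorem value_mem {E : Set (List (FreeMagma (Fin n)))} {s} (h : [s] ∈ E) :
    Q.value x s ∈ Q.superSpan x E := by
  simpa using superWordValue_mem (Q := Q) (x := x) h

theorem superSpan_linear {E : Set (List (FreeMagma (Fin n)))} {M : Type*} [AddCommGroup M]
    [Module k M] (φ : H →ₗ[k] M) {N : Submodule k M}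
    (h : ∀ l ∈ E, φ (Q.superWordValue x l) ∈ N) {y : H} (hy : y ∈ Q.superSpan x E) : φ y ∈ N := by
  have : Q.superSpan x E ≤ N.comap φ := by
    refine Submodule.span_le.2 ?_
    rintro _ ⟨l, hl, rfl⟩
    exact h l hl
  exact this hy

theorem mul_mul_mem_superSpan {E : Set (List (FreeMagma (Fin n)))} {y : H} (l₁ l₂)
    (hy : y ∈ Q.superSpan x {m | l₁ ++ m ++ l₂ ∈ E}) :
    Q.superWordValue x l₁ * y * Q.superWordValue x l₂ ∈ Q.superSpan x E := by
  refine superSpan_linear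
    ((LinearMap.mulRight k (Q.superWordValue x l₂)).comp (LinearMap.mulLeft k (Q.superWordValue x l₁)))
    (fun m hm => ?_) hy
  have : Q.superWordValue x (l₁ ++ m ++ l₂) ∈ Q.superSpan x E := superWordValue_mem hm
  simpa [superWordValue_append, mul_assoc] using this

/-- The skew commutator with a super-word is a skew derivation. -/
theorem comm_superWord_mem {E : Set (List (FreeMagma (Fin n)))} {y : H} {u : List (Fin n)}
    {l : List (FreeMagma (Fin n))}
    (h : ∀ l₁ s l₂, l = l₁ ++ s :: l₂ →
      y * Q.value x s - (Q.p u (word s) : k) • (Q.value x s * y) ∈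
        Q.superSpan x {m | l₁ ++ m ++ l₂ ∈ E}) :
    y * Q.superWordValue x l - (Q.p u (l.flatMap word) : k) • (Q.superWordValue x l * y) ∈
      Q.superSpan x E := by
  induction l generalizing E with
  | nil => simp [p_nil_right]
  | cons s l ih =>
    -- Skew Leibniz rule: `[y, s m] = [y, s] m + p(u, s) s [y, m]`.
    have h1 := mul_mul_mem_superSpan [] l (h [] s l rfl)
    have h2 := mul_mul_mem_superSpan (E := E) [s] [] (y := y * Q.superWordValue x l -
        (Q.p u (l.flatMap word) : k) • (Q.superWordValue x l * y)) (by
      refine ih fun l₁ s' l₂ e => ?_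
      have := h (s :: l₁) s' l₂ (by simp [e])
      simpa using this)
    have h3 := add_mem h1 (Submodule.smul_mem _ (Q.p u (word s) : k) h2)
    convert h3 using 1
    simp only [superWordValue_nil, one_mul, mul_one, superWordValue_cons,
      List.flatMap_cons, p_append_right, Units.val_mul, mul_smul, sub_mul, mul_sub, smul_sub,
      smul_mul_assoc, mul_smul_comm, mul_assoc]
    abel

/-- Super-words in super-letters whose words are greater than `c` in the order of lists, with the
same letters as `m`. -/
def superWordsAbove (c m : List (Fin n)) : Set (List (FreeMagma (Fin n))) :=
  {l | (∀ s ∈ l, IsStandard s ∧ c < word s) ∧ (l.flatMap word).Perm m}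

/-- The skew commutator of `[a]` and `[b]` is the super-letter of `ab` up to super-words in lesser
super-letters. -/
theorem exists_comm_sub_mem (Q : QuantumVariables k n G) (x : Fin n → H) {a b : FreeMagma (Fin n)}
    (ha : IsStandard a) (hb : IsStandard b) (h : word a < word b) :
    ∃ t, IsStandard t ∧ word t = word a ++ word b ∧
      Q.value x a * Q.value x b - (Q.p (word a) (word b) : k) • (Q.value x b * Q.value x a) -
        Q.value x t ∈ Q.superSpan x (superWordsAbove (word a ++ word b) (word a ++ word b)) := by
  -- The left word is counted twice, so that the parameter drops when `a₂` moves from the left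
  -- argument to the right one.
  induction hN : (word a).length + ((word a).length + (word b).length) using
    Nat.strong_induction_on generalizing a b with
  | _ N ih =>
  have key : ∀ {a' b' : FreeMagma (Fin n)} {c : List (Fin n)}, IsStandard a' → IsStandard b' →
      word a' < word b' →
      (word a').length + ((word a').length + (word b').length) < N →
      c < word a' ++ word b' →
      Q.value x a' * Q.value x b' - (Q.p (word a') (word b') : k) • (Q.value x b' * Q.value x a') ∈
        Q.superSpan x (superWordsAbove c (word a' ++ word b')) := by
    intro a' b' c ha' hb' h' hN' hc
    obtain ⟨t, ht, e, hm⟩ := ih _ hN' ha' hb' h' rfl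
    have h1 : Q.value x t ∈ Q.superSpan x (superWordsAbove c (word a' ++ word b')) :=
      value_mem ⟨by simp [ht, e, hc], by simp [e]⟩
    have h2 := superSpan_mono (Q := Q) (x := x) (E' := superWordsAbove c (word a' ++ word b'))
      (fun l hl => ⟨fun s hs => ⟨(hl.1 s hs).1, hc.trans (hl.1 s hs).2⟩, hl.2⟩) hm
    simpa using add_mem h2 h1
  rcases IsStandard.mul_or ha hb h with hab | ⟨a₁, a₂, rfl, h₂⟩
  · exact ⟨a * b, hab, rfl, by rw [value_mul, sub_self]; exact zero_mem _⟩
  have hlen₁ := List.length_pos_of_ne_nil (word_ne_nil a₁)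
  have hlen₂ := List.length_pos_of_ne_nil (word_ne_nil a₂)
  simp only [word_mul, List.length_append] at hN
  obtain ⟨hc₂, hc₁⟩ := ha.lt_of_mul hb h₂
  obtain ⟨t₂, ht₂, e₂, hm₂⟩ := ih _ (by omega) ha.2.1 hb h₂ rfl
  have h12 : word a₁ < word a₂ := ha.2.2.2.2.1
  have h1t : word a₁ < word t₂ := by rw [e₂]; exact h12.trans_le (le_append_self _ _)
  obtain ⟨t, ht, e, hm⟩ := ih _ (by rw [e₂]; simp; omega) ha.1 ht₂ h1t rfl
  refine ⟨t, ht, by simp [e, e₂], ?_⟩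
  set c := word (a₁ * a₂) ++ word b with hcdef
  have hc : c = word a₁ ++ (word a₂ ++ word b) := by simp [hcdef]
  set y := Q.value x a₂ * Q.value x b - (Q.p (word a₂) (word b) : k) •
    (Q.value x b * Q.value x a₂) - Q.value x t₂ with hy
  -- the commutator of `[a₁]` with the lesser part of the commutator of `[a₂]` and `[b]`
  have hY : Q.value x a₁ * y - (Q.p (word a₁) (word a₂ ++ word b) : k) • (y * Q.value x a₁) ∈
      Q.superSpan x (superWordsAbove c c) := by
    refine superSpan_linear (LinearMap.mulLeft k (Q.value x a₁) -
      (Q.p (word a₁) (word a₂ ++ word b) : k) • LinearMap.mulRight k (Q.value x a₁))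
      (fun l hl => ?_) hm₂
    -- All the super-words have the letters of `a₂b`, so one commutation factor serves for all of
    -- them.
    have hp : Q.p (word a₁) (word a₂ ++ word b) = Q.p (word a₁) (l.flatMap word) := by
      simp only [p, gr_perm Q hl.2]
    simp only [LinearMap.sub_apply, LinearMap.smul_apply, LinearMap.mulLeft_apply,
      LinearMap.mulRight_apply, hp]
    refine comm_superWord_mem fun l₁ s l₂ el => ?_
    have hs := hl.1 s (by simp [el])
    have hslen : (word s).length ≤ (word a₂).length + (word b).length := by
      have := hl.2.length_eq
      simp only [el, List.flatMap_append, List.flatMap_cons, List.length_append] at this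
      omega
    have h1 := key (c := c) ha.1 hs.1 (h12.trans ((le_append_self _ _).trans_lt hs.2)) (by omega)
      (by rw [hc, append_lt_append_left_iff]; exact hs.2)
    refine superSpan_mono ?_ h1
    refine fun m hm => ⟨fun r hr => ?_, ?_⟩
    · have hcl : ∀ r ∈ l, IsStandard r ∧ c < word r := fun r hr => ⟨(hl.1 r hr).1, by
        refine (hc₂.trans_le (le_append_self _ (word b))).trans (hl.1 r hr).2⟩
      rw [el] at hcl
      simp only [List.mem_append] at hr
      rcases hr with (hr | hr) | hr
      · exact hcl r (by simp [hr])
      · exact hm.1 r hr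
      · exact hcl r (by simp [hr])
    · have h3 := hl.2
      rw [el] at h3
      rw [hc]
      refine List.Perm.trans ?_ (h3.append_left (word a₁))
      have h4 := hm.2
      simp only [List.flatMap_append, List.flatMap_cons]
      refine ((h4.append_left _).append_right _).trans ?_
      simp only [List.append_assoc]
      refine List.Perm.trans ?_ (List.perm_append_comm_assoc _ _ _)
      simp
  have hZ := key (c := c) ha.1 hb (h12.trans h₂) (by omega) hc₁
  have ha₂ : c < word a₂ := hc₂
  have hZ1E : superWordsAbove c (word a₁ ++ word b) ⊆
      {m | [] ++ m ++ [a₂] ∈ superWordsAbove c c} := fun m hm =>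
    ⟨fun r hr => by
      simp only [List.nil_append, List.mem_append, List.mem_singleton] at hr
      rcases hr with hr | rfl
      · exact hm.1 r hr
      · exact ⟨ha.2.1, ha₂⟩, by
      simp only [List.nil_append, List.flatMap_append, List.flatMap_singleton]
      rw [hc]
      refine (hm.2.append_right _).trans ?_
      rw [List.append_assoc]
      exact List.perm_append_comm.append_left _⟩
  have hZ1 := mul_mul_mem_superSpan [] [a₂] (superSpan_mono hZ1E hZ)
  have hZ2E : superWordsAbove c (word a₁ ++ word b) ⊆
      {m | [a₂] ++ m ++ [] ∈ superWordsAbove c c} := fun m hm =>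
    ⟨fun r hr => by
      simp only [List.append_nil, List.mem_append, List.mem_singleton] at hr
      rcases hr with rfl | hr
      · exact ⟨ha.2.1, ha₂⟩
      · exact hm.1 r hr, by
      simp only [List.append_nil, List.flatMap_append, List.flatMap_singleton]
      rw [hc]
      refine (hm.2.append_left _).trans ?_
      exact List.perm_append_comm_assoc _ _ _⟩
  have hZ2 := mul_mul_mem_superSpan [a₂] [] (superSpan_mono hZ2E hZ)
  have hm' : Q.value x a₁ * Q.value x t₂ - (Q.p (word a₁) (word t₂) : k) •
      (Q.value x t₂ * Q.value x a₁) - Q.value x t ∈ Q.superSpan x (superWordsAbove c c) := by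
    have : word a₁ ++ word t₂ = c := by rw [e₂, hc]
    rwa [this] at hm
  -- Skew Jacobi identity: `[[a₁, a₂], b] = [a₁, [a₂, b]] + p(a₂, b) [a₁, b] a₂ - p(a₁, a₂) a₂ [a₁,
  -- b]`. In the last two terms every super-letter is less than that of `ab`.
  have hsum := add_mem (add_mem hm' hY) (sub_mem
    (Submodule.smul_mem _ (Q.p (word a₂) (word b) : k) hZ1)
    (Submodule.smul_mem _ (Q.p (word a₁) (word a₂) : k) hZ2))
  convert hsum using 1
  simp only [hy, e₂, value_mul, word_mul, p_append_left, p_append_right, Units.val_mul, sub_mul,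
    mul_sub, smul_sub, smul_mul_assoc, mul_smul_comm, mul_assoc, superWordValue_nil, one_mul,
    mul_one, superWordValue_singleton, smul_smul]
  module

/-- The skew commutator of `[a]` and `[b]` is a combination of super-words in super-letters that
are not greater than that of `ab`. -/
theorem comm_mem (Q : QuantumVariables k n G) (x : Fin n → H) {a b : FreeMagma (Fin n)}
    {c : List (Fin n)} (ha : IsStandard a) (hb : IsStandard b) (h : word a < word b)
    (hc : c < word a ++ word b) :
    Q.value x a * Q.value x b - (Q.p (word a) (word b) : k) • (Q.value x b * Q.value x a) ∈
      Q.superSpan x (superWordsAbove c (word a ++ word b)) := by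
  obtain ⟨t, ht, e, hm⟩ := exists_comm_sub_mem Q x ha hb h
  have h1 : Q.value x t ∈ Q.superSpan x (superWordsAbove c (word a ++ word b)) :=
    value_mem ⟨by simp [ht, e, hc], by simp [e]⟩
  have h2 := superSpan_mono (Q := Q) (x := x) (E' := superWordsAbove c (word a ++ word b))
    (fun l hl => ⟨fun s hs => ⟨(hl.1 s hs).1, hc.trans (hl.1 s hs).2⟩, hl.2⟩) hm
  simpa using add_mem h2 h1

end QuantumVariables
/-- `v` precedes `u`: it has a lesser degree, or the same degree and is less than `u`. -/
def Below {n : ℕ} {D : Type*} [AddCommGroup D] [LinearOrder D] (d : Fin n → D)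
    (v u : List (Fin n)) : Prop :=
  degree d v < degree d u ∨ degree d v = degree d u ∧ WordLT v u

/-! ### The order by degree and then lexicographically -/

section Below

variable {n : ℕ} {D : Type*} [AddCommGroup D] [LinearOrder D] {d : Fin n → D}

theorem Below.trans {u v w : List (Fin n)} (h : Below d u v) (h' : Below d v w) : Below d u w := by
  rcases h with h | ⟨h, h1⟩ <;> rcases h' with h' | ⟨h', h2⟩
  · exact Or.inl (h.trans h')
  · exact Or.inl (h' ▸ h)
  · exact Or.inl (h ▸ h')
  · exact Or.inr ⟨h.trans h', lt_trans (show w < v from h2) h1⟩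

theorem not_below_self (u : List (Fin n)) : ¬ Below d u u := by
  simp [Below, WordLT]

theorem below_trichotomy (u v : List (Fin n)) : Below d u v ∨ u = v ∨ Below d v u := by
  rcases lt_trichotomy (degree d u) (degree d v) with h | h | h
  · exact Or.inl (Or.inl h)
  · rcases lt_trichotomy u v with h' | h' | h'
    · exact Or.inr (Or.inr (Or.inr ⟨h.symm, h'⟩))
    · exact Or.inr (Or.inl h')
    · exact Or.inl (Or.inr ⟨h, h'⟩)
  · exact Or.inr (Or.inr (Or.inl h))

end Below

/-! ### Reduction of super-letters that contain the leading word -/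

namespace QuantumVariables

variable {k : Type u} [Field k] {n : ℕ} {G : Type v} [CommGroup G] (Q : QuantumVariables k n G)
  {H : Type w} [Ring H] [Algebra k H] {x : Fin n → H}
  {D : Type*} [AddCommGroup D] [LinearOrder D] (d : Fin n → D)

/-- Super-words in super-letters less than `u` of the same degree and the same `G × G^*`-degree as
`u`, and all super-words of lesser degree. -/
def superWordsBelow (u : List (Fin n)) : Set (List (FreeMagma (Fin n))) :=
  {l | (∀ s ∈ l, IsStandard s) ∧
    (degree d (l.flatMap word) < degree d u ∨
      (∀ s ∈ l, u < word s) ∧ degree d (l.flatMap word) = degree d u ∧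
        Q.gr (l.flatMap word) = Q.gr u ∧ Q.chr (l.flatMap word) = Q.chr u)}

theorem superWordsAbove_subset (u : List (Fin n)) :
    superWordsAbove u u ⊆ Q.superWordsBelow d u := fun _ hl =>
  ⟨fun s hs => (hl.1 s hs).1, Or.inr ⟨fun s hs => (hl.1 s hs).2, degree_perm d hl.2,
    gr_perm Q hl.2, chr_perm Q hl.2⟩⟩

variable {Q} {d}

/-- If the relation `f^* = 0` holds, then a super-letter whose word contains the leading word of `f`
is a combination of lesser super-words. -/
theorem value_mem_of_infix [IsOrderedAddMonoid D] (hd : ∀ i, 0 < d i)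
    {f : FreeMagma (Fin n) →₀ k} (hf : ∀ t ∈ f.support, IsStandard t) (hom : Q.IsHomogeneous f)
    (hx : FreeAlgebra.lift k x (Q.star f) = 0) {r : FreeMagma (Fin n)} (hr : r ∈ f.support)
    (hlead : ∀ s ∈ f.support, s ≠ r → Below d (word s) (word r))
    {t : FreeMagma (Fin n)} (ht : IsStandard t) (hrt : word r <:+: word t) :
    Q.value x t ∈ Q.superSpan x (Q.superWordsBelow d (word t)) := by
  induction hN : (word t).length using Nat.strong_induction_on generalizing t with
  | _ N ih =>
  by_cases hne : word r = word t
  · obtain rfl := (hf r hr).eq_of_word_eq ht hne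
    -- The relation is solved for its leading term; homogeneity gives the remaining terms the same
    -- `G × G^*`-degree.
    have h0 : f r • Q.value x r + ∑ s ∈ f.support.erase r, f s • Q.value x s = 0 := by
      rw [Finset.add_sum_erase _ (fun s => f s • Q.value x s) hr, ← hx, star, Finsupp.sum, map_sum]
      simp [value]
    have h1 : Q.value x r = -((f r)⁻¹ • ∑ s ∈ f.support.erase r, f s • Q.value x s) := by
      rw [eq_neg_of_add_eq_zero_right h0, smul_neg, neg_neg, smul_smul,
        inv_mul_cancel₀ (Finsupp.mem_support_iff.1 hr), one_smul]
    rw [h1]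
    refine neg_mem (Submodule.smul_mem _ _ (sum_mem fun s hs => Submodule.smul_mem _ _ ?_))
    rw [Finset.mem_erase] at hs
    refine value_mem ⟨by simpa using hf s hs.2, ?_⟩
    simp only [List.flatMap_singleton, List.mem_singleton, forall_eq]
    refine (hlead s hs.2 hs.1).imp id fun h => ⟨h.2, h.1, ?_⟩
    exact hom s hs.2 r hr
  obtain ⟨a, b, ha, hb, et, hlt, hab⟩ := ht.exists_split_of_infix (hf r hr).isStandardWord hrt hne
  have hlenb := List.length_pos_of_ne_nil (word_ne_nil b)
  have hlena := List.length_pos_of_ne_nil (word_ne_nil a)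
  have hltb : word a ++ word b < word b := by
    have := ht.isStandardWord
    rw [et] at this
    exact this.lt_suffix (word_ne_nil a) (word_ne_nil b)
  -- it is sufficient to consider the skew commutator of `[a]` and `[b]`
  suffices hcomm : Q.value x a * Q.value x b -
      (Q.p (word a) (word b) : k) • (Q.value x b * Q.value x a) ∈
        Q.superSpan x (Q.superWordsBelow d (word t)) by
    obtain ⟨t', ht', e', hm⟩ := exists_comm_sub_mem Q x ha hb hlt
    obtain rfl := ht'.eq_of_word_eq ht (e'.trans et.symm)
    have := sub_mem hcomm (superSpan_mono (superWordsAbove_subset Q d _) (et ▸ hm))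
    simpa using this
  have hdeg : degree d (word t) = degree d (word a) + degree d (word b) := by
    rw [et, degree_append]
  rcases hab with h | h
  · have hA := ih _ (by rw [← hN, et]; simp; omega) ha h rfl
    have hmem : ∀ l ∈ Q.superWordsBelow d (word a),
        l ++ [b] ∈ Q.superWordsBelow d (word t) ∧ [b] ++ l ∈ Q.superWordsBelow d (word t) := by
      intro l hl
      have hstd : ∀ s, s ∈ l ∨ s = b → IsStandard s := by
        rintro s (hs | rfl)
        exacts [hl.1 s hs, hb]
      have hD : degree d (l.flatMap word) < degree d (word a) ∨ (∀ s, s ∈ l ∨ s = b →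
          word t < word s) ∧ degree d (l.flatMap word) = degree d (word a) ∧
            Q.gr (l.flatMap word) = Q.gr (word a) ∧ Q.chr (l.flatMap word) = Q.chr (word a) := by
        refine hl.2.imp id fun h => ⟨?_, h.2⟩
        rintro s (hs | rfl)
        -- By degrees `a` is not a beginning of `s`, so `a < s` survives prolongation of `a` to
        -- `ab`.
        · rw [et]
          exact append_lt_of_not_prefix (h.1 s hs) (not_prefix_of_degree_le hd (h.1 s hs)
            ((degree_le_of_mem hd hs).trans h.2.1.le)) _
        · rwa [et]
      constructor
      · refine ⟨fun s hs => hstd s (by simpa using hs), ?_⟩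
        refine hD.imp (fun h => ?_) fun h => ⟨fun s hs => h.1 s (by simpa using hs), ?_⟩
        · simpa [hdeg, degree_append] using h
        · simp [et, degree_append, gr_append, chr_append, h.2]
      · refine ⟨fun s hs => hstd s (by simpa [or_comm] using hs), ?_⟩
        refine hD.imp (fun h => ?_) fun h => ⟨fun s hs => h.1 s (by simpa [or_comm] using hs), ?_⟩
        · simpa [hdeg, degree_append, add_comm] using h
        · simp [et, degree_append, gr_append, chr_append, h.2, add_comm, mul_comm]
    have h1 := mul_mul_mem_superSpan [] [b] (superSpan_mono (E' := {m | [] ++ m ++ [b] ∈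
      Q.superWordsBelow d (word t)}) (fun l hl => by simpa using (hmem l hl).1) hA)
    have h2 := mul_mul_mem_superSpan [b] [] (superSpan_mono (E' := {m | [b] ++ m ++ [] ∈
      Q.superWordsBelow d (word t)}) (fun l hl => by simpa using (hmem l hl).2) hA)
    simp only [superWordValue_nil, superWordValue_singleton, one_mul, mul_one] at h1 h2
    exact sub_mem h1 (Submodule.smul_mem _ _ h2)
  · have hB := ih _ (by rw [← hN, et]; simp; omega) hb h rfl
    -- The products cannot be treated separately here: `[a]` is not less than `[ab]`, being a
    -- beginning. Only the commutator eliminates `[a]` in top degree.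
    refine superSpan_linear (LinearMap.mulLeft k (Q.value x a) -
      (Q.p (word a) (word b) : k) • LinearMap.mulRight k (Q.value x a)) (fun l hl => ?_) hB
    simp only [LinearMap.sub_apply, LinearMap.smul_apply, LinearMap.mulLeft_apply,
      LinearMap.mulRight_apply]
    rcases hl.2 with h' | ⟨h1, h2, h3, h4⟩
    · refine sub_mem ?_ (Submodule.smul_mem _ _ ?_)
      · rw [← superWordValue_cons]
        refine superWordValue_mem ⟨by simpa using ⟨ha, hl.1⟩, Or.inl ?_⟩
        simpa [hdeg, degree_append] using h'
      · have : l ++ [a] ∈ Q.superWordsBelow d (word t) := by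
          refine ⟨?_, Or.inl ?_⟩
          · intro s hs
            simp only [List.mem_append, List.mem_singleton] at hs
            rcases hs with hs | rfl
            exacts [hl.1 s hs, ha]
          · rw [List.flatMap_append, degree_append, hdeg, add_comm (degree d (word a))]
            simpa using h'
        simpa [superWordValue_append] using superWordValue_mem (x := x) this
    -- Equality of the `G`-degrees makes this the correct commutation factor, so the skew Leibniz
    -- rule applies.
    · have hp : Q.p (word a) (word b) = Q.p (word a) (l.flatMap word) := by simp only [p, h3]
      rw [hp]
      refine comm_superWord_mem fun l₁ s l₂ el => ?_
      have hs := h1 s (by simp [el])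
      have hc : word t < word a ++ word s := by rwa [et, append_lt_append_left_iff]
      refine superSpan_mono ?_ (comm_mem Q x ha (hl.1 s (by simp [el])) (hlt.trans hs) hc)
      intro m hm
      have hall : ∀ r ∈ l, IsStandard r ∧ word t < word r := fun r hr =>
        ⟨hl.1 r hr, by rw [et]; exact hltb.trans (h1 r hr)⟩
      have hall' : ∀ r ∈ l₁ ++ m ++ l₂, IsStandard r ∧ word t < word r := by
        rw [el] at hall
        intro r hr
        simp only [List.mem_append] at hr
        rcases hr with (hr | hr) | hr
        · exact hall r (by simp [hr])
        · exact hm.1 r hr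
        · exact hall r (by simp [hr])
      have hperm : ((l₁ ++ m ++ l₂).flatMap word).Perm (word a ++ l.flatMap word) := by
        simp only [el, List.flatMap_append, List.flatMap_cons]
        refine ((hm.2.append_left _).append_right _).trans ?_
        simp only [List.append_assoc]
        exact List.perm_append_comm_assoc _ _ _
      refine ⟨fun r hr => (hall' r hr).1, Or.inr ⟨fun r hr => (hall' r hr).2, ?_, ?_, ?_⟩⟩
      · rw [degree_perm d hperm, degree_append, h2, hdeg]
      · rw [gr_perm Q hperm, gr_append, h3, et, gr_append]
      · rw [chr_perm Q hperm, chr_append, h4, et, chr_append]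

end QuantumVariables

/-! ### Lie algebras -/

section Lie

variable {k : Type u} [Field k] {n : ℕ} {L : Type w} [LieRing L] [LieAlgebra k L] (x : Fin n → L)

theorem lieValue_mul (s t : FreeMagma (Fin n)) :
    lieValue x (s * t) = ⁅lieValue x s, lieValue x t⁆ := rfl

variable (k) in
/-- The span of the values of a set of nonassociative words. -/
def lieSpanOf (E : Set (FreeMagma (Fin n))) : Submodule k L :=
  Submodule.span k (lieValue x '' E)

variable {x}

theorem lieSpanOf_mono {E E' : Set (FreeMagma (Fin n))} (h : E ⊆ E') :
    lieSpanOf k x E ≤ lieSpanOf k x E' :=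
  Submodule.span_mono (Set.image_mono h)

theorem lieValue_mem {E : Set (FreeMagma (Fin n))} {s} (h : s ∈ E) :
    lieValue x s ∈ lieSpanOf k x E :=
  Submodule.subset_span ⟨s, h, rfl⟩

theorem lie_mem_of_forall {E : Set (FreeMagma (Fin n))} {N : Submodule k L} {y z : L}
    (hz : z ∈ lieSpanOf k x E) (h : ∀ s ∈ E, ⁅y, lieValue x s⁆ ∈ N) : ⁅y, z⁆ ∈ N := by
  have : lieSpanOf k x E ≤ N.comap (LieAlgebra.ad k L y : L →ₗ[k] L) := by
    refine Submodule.span_le.2 ?_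
    rintro _ ⟨s, hs, rfl⟩
    exact h s hs
  exact this hz

/-- Standard nonassociative words whose words are greater than `c` in the order of lists, with the
same letters as `m`. -/
def treesAbove (c m : List (Fin n)) : Set (FreeMagma (Fin n)) :=
  {s | IsStandard s ∧ c < word s ∧ (word s).Perm m}

theorem treesAbove_subset {c c' m m' : List (Fin n)} (h : c' ≤ c) (hm : m.Perm m') :
    treesAbove c m ⊆ treesAbove c' m' :=
  fun _ hs => ⟨hs.1, h.trans_lt hs.2.1, hs.2.2.trans hm⟩

/-- The bracket of `[a]` and `[b]` is the standard nonassociative word of `ab` up to lesser ones. -/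
theorem exists_lie_sub_mem (k : Type u) [Field k] [LieAlgebra k L] (x : Fin n → L)
    {a b : FreeMagma (Fin n)}
    (ha : IsStandard a) (hb : IsStandard b) (h : word a < word b) :
    ∃ t, IsStandard t ∧ word t = word a ++ word b ∧
      ⁅lieValue x a, lieValue x b⁆ - lieValue x t ∈
        lieSpanOf k x (treesAbove (word a ++ word b) (word a ++ word b)) := by
  -- Three nested inductions: on the length of `ab`, on the number of words of that length greater
  -- than `ab`, and on the length of `a`. They serve respectively the inner brackets, the brackets
  -- with greater product, and `[a₁, t₂]`, whose product is again `ab`.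
  induction hN : (word a).length + (word b).length using Nat.strong_induction_on
    generalizing a b with
  | _ N ihN =>
  induction hM : {v : List (Fin n) | v.length = N ∧ word a ++ word b < v}.ncard using
    Nat.strong_induction_on generalizing a b with
  | _ M ihM =>
  induction hK : (word a).length using Nat.strong_induction_on generalizing a b with
  | _ K ihK =>
  have conv : ∀ {a' b' : FreeMagma (Fin n)} {c m : List (Fin n)},
      (word a' ++ word b').Perm m → c < word a' ++ word b' →
      (∃ t, IsStandard t ∧ word t = word a' ++ word b' ∧
        ⁅lieValue x a', lieValue x b'⁆ - lieValue x t ∈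
          lieSpanOf k x (treesAbove (word a' ++ word b') (word a' ++ word b'))) →
      ⁅lieValue x a', lieValue x b'⁆ ∈ lieSpanOf k x (treesAbove c m) := by
    rintro a' b' c m hm hc ⟨t, ht, e, hmem⟩
    have h1 : lieValue x t ∈ lieSpanOf k x (treesAbove c m) :=
      lieValue_mem ⟨ht, by rwa [e], by rwa [e]⟩
    simpa using add_mem (lieSpanOf_mono (treesAbove_subset hc.le hm) hmem) h1
  rcases IsStandard.mul_or ha hb h with hab | ⟨a₁, a₂, rfl, h₂⟩
  · exact ⟨a * b, hab, rfl, by rw [lieValue_mul, sub_self]; exact zero_mem _⟩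
  have hlen₁ := List.length_pos_of_ne_nil (word_ne_nil a₁)
  have hlen₂ := List.length_pos_of_ne_nil (word_ne_nil a₂)
  obtain ⟨hc₂, hc₁⟩ := ha.lt_of_mul hb h₂
  have h12 : word a₁ < word a₂ := ha.2.2.2.2.1
  set c := word (a₁ * a₂) ++ word b with hcdef
  have hc : c = word a₁ ++ (word a₂ ++ word b) := by simp [hcdef]
  have hcN : c.length = N := by rw [← hN, hcdef, List.length_append]
  have hN' : (word a₁).length + (word a₂).length + (word b).length = N := by
    rw [← hN]; simp
  have hK' : (word a₁).length + (word a₂).length = K := by rw [← hK]; simp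
  -- brackets with the same letters and a greater product
  have key : ∀ {a' b' : FreeMagma (Fin n)}, IsStandard a' → IsStandard b' → word a' < word b' →
      (word a' ++ word b').Perm c → c < word a' ++ word b' →
      ⁅lieValue x a', lieValue x b'⁆ ∈ lieSpanOf k x (treesAbove c c) := by
    intro a' b' ha' hb' h' hp hlt
    have hlen : (word a').length + (word b').length = N := by
      rw [← List.length_append, hp.length_eq, hcN]
    refine conv hp hlt (ihM _ ?_ ha' hb' h' hlen rfl)
    rw [← hM]
    refine Set.ncard_lt_ncard ?_ ((List.finite_length_eq (Fin n) N).subset fun v hv => hv.1)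
    refine ⟨fun v hv => ⟨hv.1, hlt.trans hv.2⟩, fun hsub => ?_⟩
    have : word a' ++ word b' ∈ {v : List (Fin n) | v.length = N ∧ word a' ++ word b' < v} :=
      hsub ⟨by rw [hp.length_eq, hcN], hlt⟩
    exact lt_irrefl _ this.2
  obtain ⟨t₂, ht₂, e₂, hm₂⟩ := ihN _ (by omega) ha.2.1 hb h₂ rfl
  have h1t : word a₁ < word t₂ := by rw [e₂]; exact h12.trans_le (le_append_self _ _)
  have e1t : word a₁ ++ word t₂ = c := by rw [e₂, hc]
  obtain ⟨t, ht, e, hm⟩ := ihK _ (by omega) ha.1 ht₂ h1t (by rw [e₂, List.length_append]; omega)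
    (by rw [← hM, e1t]) rfl
  rw [e1t] at e hm
  refine ⟨t, ht, e, ?_⟩
  have hY : ⁅lieValue x a₁, ⁅lieValue x a₂, lieValue x b⁆ - lieValue x t₂⁆ ∈
      lieSpanOf k x (treesAbove c c) := by
    refine lie_mem_of_forall hm₂ fun s hs => key ha.1 hs.1 ?_ ?_ ?_
    · exact h12.trans ((le_append_self _ _).trans_lt hs.2.1)
    · rw [hc]; exact hs.2.2.append_left _
    · rw [hc, append_lt_append_left_iff]; exact hs.2.1
  have h1b := conv (c := c) (List.Perm.refl _) hc₁ (ihN _ (by omega) ha.1 hb (h12.trans h₂) rfl)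
  -- Both `a₂` and every `s` from `[a₁, b]` exceed `c`, so their product exceeds `c` in either
  -- order.
  have hZ : ⁅lieValue x a₂, ⁅lieValue x a₁, lieValue x b⁆⁆ ∈
      lieSpanOf k x (treesAbove c c) := by
    refine lie_mem_of_forall h1b fun s hs => ?_
    have hp : (word a₂ ++ word s).Perm c := by
      rw [hc]
      exact (hs.2.2.append_left _).trans (List.perm_append_comm_assoc _ _ _)
    rcases lt_trichotomy (word a₂) (word s) with hlt | heq | hlt
    · exact key ha.2.1 hs.1 hlt hp (hc₂.trans_le (le_append_self _ _))
    · rw [ha.2.1.eq_of_word_eq hs.1 heq, lie_self]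
      exact zero_mem _
    · rw [← lie_skew]
      exact neg_mem (key hs.1 ha.2.1 hlt (List.perm_append_comm.trans hp)
        (hs.2.1.trans_le (le_append_self _ _)))
  have := sub_mem (add_mem hm hY) hZ
  convert this using 1
  rw [lieValue_mul, lie_sub, lie_lie]
  abel

/-- The bracket of `[a]` and `[b]` is a combination of standard nonassociative words that are not
greater than that of the product of `a` and `b` in increasing order of lists. -/
theorem lie_mem (k : Type u) [Field k] [LieAlgebra k L] (x : Fin n → L) {a b : FreeMagma (Fin n)}
    {c : List (Fin n)} (ha : IsStandard a) (hb : IsStandard b)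
    (hca : word a ≤ word b → c < word a ++ word b) (hcb : word b < word a → c < word b ++ word a) :
    ⁅lieValue x a, lieValue x b⁆ ∈ lieSpanOf k x (treesAbove c (word a ++ word b)) := by
  have key : ∀ {a b : FreeMagma (Fin n)}, IsStandard a → IsStandard b → word a < word b →
      c < word a ++ word b →
      ⁅lieValue x a, lieValue x b⁆ ∈ lieSpanOf k x (treesAbove c (word a ++ word b)) := by
    intro a b ha hb hlt hc
    obtain ⟨t, ht, e, hmem⟩ := exists_lie_sub_mem k x ha hb hlt
    have h1 : lieValue x t ∈ lieSpanOf k x (treesAbove c (word a ++ word b)) :=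
      lieValue_mem ⟨ht, by rwa [e], by rw [e]⟩
    simpa using add_mem (lieSpanOf_mono (treesAbove_subset hc.le (List.Perm.refl _)) hmem) h1
  rcases lt_trichotomy (word a) (word b) with hlt | heq | hlt
  · exact key ha hb hlt (hca hlt.le)
  · rw [ha.eq_of_word_eq hb heq, lie_self]
    exact zero_mem _
  · rw [← lie_skew]
    exact neg_mem (lieSpanOf_mono (treesAbove_subset le_rfl List.perm_append_comm)
      (key hb ha hlt (hcb hlt)))

variable {D : Type*} [AddCommGroup D] [LinearOrder D] {d : Fin n → D}

/-- If the relation `f = 0` holds, then a standard nonassociative word containing the leading word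
of `f` is a combination of lesser ones. -/
theorem lieValue_mem_of_infix [IsOrderedAddMonoid D] (hd : ∀ i, 0 < d i)
    {f : FreeMagma (Fin n) →₀ k} (hf : ∀ t ∈ f.support, IsStandard t)
    (hx : f.sum (fun t c => c • lieValue x t) = 0) {r : FreeMagma (Fin n)} (hr : r ∈ f.support)
    (hlead : ∀ s ∈ f.support, s ≠ r → Below d (word s) (word r))
    {t : FreeMagma (Fin n)} (ht : IsStandard t) (hrt : word r <:+: word t) :
    lieValue x t ∈ lieSpanOf k x {s | IsStandard s ∧ Below d (word s) (word t)} := by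
  induction hN : (word t).length using Nat.strong_induction_on generalizing t with
  | _ N ih =>
  by_cases hne : word r = word t
  · obtain rfl := (hf r hr).eq_of_word_eq ht hne
    have h0 : f r • lieValue x r + ∑ s ∈ f.support.erase r, f s • lieValue x s = 0 := by
      rw [Finset.add_sum_erase _ (fun s => f s • lieValue x s) hr, ← hx, Finsupp.sum]
    have h1 : lieValue x r = -((f r)⁻¹ • ∑ s ∈ f.support.erase r, f s • lieValue x s) := by
      rw [eq_neg_of_add_eq_zero_right h0, smul_neg, neg_neg, smul_smul,
        inv_mul_cancel₀ (Finsupp.mem_support_iff.1 hr), one_smul]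
    rw [h1]
    refine neg_mem (Submodule.smul_mem _ _ (sum_mem fun s hs => Submodule.smul_mem _ _ ?_))
    rw [Finset.mem_erase] at hs
    exact lieValue_mem ⟨hf s hs.2, hlead s hs.2 hs.1⟩
  obtain ⟨a, b, ha, hb, et, hlt, hab⟩ := ht.exists_split_of_infix (hf r hr).isStandardWord hrt hne
  have hlenb := List.length_pos_of_ne_nil (word_ne_nil b)
  have hlena := List.length_pos_of_ne_nil (word_ne_nil a)
  have hltb : word a ++ word b < word b := by
    have := ht.isStandardWord
    rw [et] at this
    exact this.lt_suffix (word_ne_nil a) (word_ne_nil b)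
  have hdeg : degree d (word t) = degree d (word a) + degree d (word b) := by
    rw [et, degree_append]
  -- it is sufficient to consider the bracket of `[a]` and `[b]`
  suffices hcomm : ⁅lieValue x a, lieValue x b⁆ ∈
      lieSpanOf k x {s | IsStandard s ∧ Below d (word s) (word t)} by
    obtain ⟨t', ht', e', hm⟩ := exists_lie_sub_mem k x ha hb hlt
    obtain rfl := ht'.eq_of_word_eq ht (e'.trans et.symm)
    have hsub : treesAbove (word a ++ word b) (word a ++ word b) ⊆
        {s | IsStandard s ∧ Below d (word s) (word t')} := fun s hs =>
      ⟨hs.1, Or.inr ⟨by rw [e']; exact degree_perm d hs.2.2, by rw [e']; exact hs.2.1⟩⟩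
    simpa using sub_mem hcomm (lieSpanOf_mono hsub hm)
  have lower : ∀ {s s' : FreeMagma (Fin n)}, IsStandard s → IsStandard s' →
      degree d (word s) + degree d (word s') < degree d (word t) →
      ⁅lieValue x s, lieValue x s'⁆ ∈
        lieSpanOf k x {s | IsStandard s ∧ Below d (word s) (word t)} := by
    intro s s' hs hs' hlt
    -- The bound `[]` is no restriction on nonempty words: in lesser degree the lexicographic
    -- comparison is irrelevant.
    refine lieSpanOf_mono ?_ (lie_mem (c := []) k x hs hs' ?_ ?_)
    · exact fun r hr => ⟨hr.1, Or.inl (by rwa [degree_perm d hr.2.2, degree_append])⟩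
    · exact fun _ => lt_append_self [] (by simp [word_ne_nil])
    · exact fun _ => lt_append_self [] (by simp [word_ne_nil])
  have same : ∀ {s s' : FreeMagma (Fin n)}, IsStandard s → IsStandard s' →
      degree d (word s) + degree d (word s') = degree d (word t) →
      (word s ≤ word s' → word t < word s ++ word s') →
      (word s' < word s → word t < word s' ++ word s) →
      ⁅lieValue x s, lieValue x s'⁆ ∈
        lieSpanOf k x {s | IsStandard s ∧ Below d (word s) (word t)} := by
    intro s s' hs hs' hD h1 h2
    refine lieSpanOf_mono ?_ (lie_mem k x hs hs' h1 h2)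
    exact fun r hr => ⟨hr.1, Or.inr ⟨by rw [degree_perm d hr.2.2, degree_append, hD], hr.2.1⟩⟩
  rcases hab with h | h
  · have hA := ih _ (by rw [← hN, et]; simp; omega) ha h rfl
    rw [← lie_skew]
    refine neg_mem (lie_mem_of_forall hA ?_)
    rintro s ⟨hs, h' | ⟨h', h1⟩⟩
    · exact lower hb hs (by rw [hdeg, add_comm]; simpa using h')
    · have hts : word t < word s := by
        rw [et]
        exact append_lt_of_not_prefix h1 (not_prefix_of_degree_le hd h1 h'.le) _
      have htb : word t < word b := by rwa [et]
      exact same hb hs (by rw [hdeg, h', add_comm])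
        (fun _ => htb.trans_le (le_append_self _ _)) (fun _ => hts.trans_le (le_append_self _ _))
  · have hB := ih _ (by rw [← hN, et]; simp; omega) hb h rfl
    refine lie_mem_of_forall hB ?_
    rintro s ⟨hs, h' | ⟨h', h1⟩⟩
    · exact lower ha hs (by rw [hdeg]; simpa using h')
    · have h1 : word b < word s := h1
      refine same ha hs (by rw [hdeg, h']) (fun _ => ?_) (fun h2 => ?_)
      · rwa [et, append_lt_append_left_iff]
      · exact absurd (hlt.trans h1) h2.asymm

end Lie
-- Compatibility with products and well-foundedness
section Order

variable {n : ℕ} {D : Type*} [AddCommGroup D] [LinearOrder D] [IsOrderedAddMonoid D] {d : Fin n → D}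

/-- Distinct words of equal degree are not beginnings of each other, as letters have positive
degree; so right multiplication preserves their comparison. -/
theorem Below.append_append (hd : ∀ i, 0 < d i) {u v : List (Fin n)} (h : Below d v u)
    (a b : List (Fin n)) : Below d (a ++ v ++ b) (a ++ u ++ b) := by
  rcases h with h | ⟨h, h'⟩
  · exact Or.inl (by simpa [degree_append] using h)
  · refine Or.inr ⟨by simp [degree_append, h], ?_⟩
    have h' : u < v := h'
    change a ++ u ++ b < a ++ v ++ b
    rw [List.append_assoc, List.append_assoc, append_lt_append_left_iff]
    exact append_lt_append_of_not_prefix h' (not_prefix_of_degree_le hd h' h.le) b b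

/-- Deleting a letter strictly lowers the degree. Hence an earlier word of a descending chain cannot
embed in a later one, which Higman's lemma would force. -/
theorem degree_le_of_sublistForall₂ (hd : ∀ i, 0 < d i) {u v : List (Fin n)}
    (h : List.SublistForall₂ (· = ·) u v) :
    degree d u ≤ degree d v ∧ (degree d u = degree d v → u = v) := by
  induction h with
  | @nil v =>
    refine ⟨degree_nonneg hd v, fun h => ?_⟩
    by_contra hne
    exact (degree_pos hd (Ne.symm hne)).ne h
  | @cons a₁ a₂ l₁ l₂ e _ ih =>
    subst e
    simp only [degree, List.map_cons, List.sum_cons, add_le_add_iff_left, add_right_inj,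
      List.cons.injEq, true_and]
    exact ih
  | @cons_right a l₁ l₂ _ ih =>
    have : degree d l₁ < degree d (a :: l₂) := by
      refine ih.1.trans_lt ?_
      simpa [degree] using hd a
    exact ⟨this.le, fun h => absurd h this.ne⟩

/-- Since the subword order is a well-quasi-order (Higman), the order on words is well-founded. -/
theorem wellFounded_below (hd : ∀ i, 0 < d i) : WellFounded (Below d) := by
  rw [wellFounded_iff_isEmpty_descending_chain]
  refine ⟨fun ⟨f, hf⟩ => ?_⟩
  have hpwo : (Set.univ : Set (Fin n)).PartiallyWellOrderedOn (· = ·) :=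
    Set.finite_univ.partiallyWellOrderedOn
  have h := Set.PartiallyWellOrderedOn.partiallyWellOrderedOn_sublistForall₂ (· = ·) hpwo
  obtain ⟨i, j, hij, hs⟩ := h (fun m => ⟨f m, fun _ _ => trivial⟩)
  have hlt : ∀ i j, i < j → Below d (f j) (f i) := by
    intro i j hij
    induction hij with
    | refl => exact hf i
    | step _ ih => exact (hf _).trans ih
  have hb := hlt i j hij
  obtain ⟨h1, h2⟩ := degree_le_of_sublistForall₂ hd (d := d) (u := f i) (v := f j) hs
  rcases hb with hb | ⟨hb, hb'⟩
  · exact not_lt.2 h1 hb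
  · rw [h2 hb.symm] at hb'
    exact lt_irrefl (f j) hb'

end Order

/-! ### Leading words in the free algebra -/

section FreeAlgebra

variable {k : Type u} [Field k] {n : ℕ}

variable (k) in
/-- The monomial of a word. -/
noncomputable def monomial (u : List (Fin n)) : FreeAlgebra k (Fin n) :=
  (u.map (FreeAlgebra.ι k)).prod

theorem monomial_append (u v : List (Fin n)) :
    monomial k (u ++ v) = monomial k u * monomial k v := by simp [monomial]

@[simp] theorem monomial_nil : monomial k ([] : List (Fin n)) = 1 := by simp [monomial]

theorem basisFreeMonoid_apply (u : List (Fin n)) :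
    FreeAlgebra.basisFreeMonoid k (Fin n) (FreeMonoid.ofList u) = monomial k u := by
  rw [← (FreeAlgebra.equivMonoidAlgebraFreeMonoid (R := k) (X := Fin n)).injective.eq_iff]
  have h1 : FreeAlgebra.equivMonoidAlgebraFreeMonoid
      (FreeAlgebra.basisFreeMonoid k (Fin n) (FreeMonoid.ofList u)) =
      MonoidAlgebra.of k (FreeMonoid (Fin n)) (FreeMonoid.ofList u) := by
    simp only [FreeAlgebra.basisFreeMonoid, Module.Basis.map_apply]
    exact (FreeAlgebra.equivMonoidAlgebraFreeMonoid.toLinearEquiv).apply_symm_apply _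
  rw [h1]
  induction u with
  | nil => simp [monomial, MonoidAlgebra.one_def]
  | cons i u ih =>
    have h2 : monomial k (i :: u) = FreeAlgebra.ι k i * monomial k u := by simp [monomial]
    rw [h2, map_mul, FreeMonoid.ofList_cons, map_mul, ih]
    · simp [FreeAlgebra.equivMonoidAlgebraFreeMonoid]
    · simp only [FreeAlgebra.basisFreeMonoid, Module.Basis.map_apply]
      exact (FreeAlgebra.equivMonoidAlgebraFreeMonoid.toLinearEquiv).apply_symm_apply _

variable (k) in
/-- The coefficient of a word in a noncommutative polynomial. -/
noncomputable def wordCoeff (u : List (Fin n)) : FreeAlgebra k (Fin n) →ₗ[k] k :=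
  (FreeAlgebra.basisFreeMonoid k (Fin n)).coord (FreeMonoid.ofList u)

theorem wordCoeff_self (u : List (Fin n)) : wordCoeff k u (monomial k u) = 1 := by
  rw [wordCoeff, ← basisFreeMonoid_apply]; simp

theorem wordCoeff_of_ne {u v : List (Fin n)} (h : v ≠ u) : wordCoeff k u (monomial k v) = 0 := by
  rw [wordCoeff, ← basisFreeMonoid_apply, Module.Basis.coord_apply, Module.Basis.repr_self,
    Finsupp.single_apply_eq_zero]
  intro e
  exact absurd (FreeMonoid.ofList.injective e).symm h

theorem span_monomial : Submodule.span k (Set.range (monomial k (n := n))) = ⊤ := by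
  rw [← (FreeAlgebra.basisFreeMonoid k (Fin n)).span_eq]
  congr 1
  ext y
  constructor
  · rintro ⟨u, rfl⟩
    exact ⟨FreeMonoid.ofList u, basisFreeMonoid_apply u⟩
  · rintro ⟨u, rfl⟩
    exact ⟨FreeMonoid.toList u, (basisFreeMonoid_apply _).symm⟩

variable {D : Type*} [AddCommGroup D] [LinearOrder D] {d : Fin n → D}

variable (k d) in
/-- The span of the words that precede `u`. -/
def lowerSpan (u : List (Fin n)) : Submodule k (FreeAlgebra k (Fin n)) :=
  Submodule.span k (monomial k '' {v | Below d v u})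

theorem monomial_mem_lowerSpan {u v : List (Fin n)} (h : Below d v u) :
    monomial k v ∈ lowerSpan k d u := Submodule.subset_span ⟨v, h, rfl⟩

theorem lowerSpan_mono {u v : List (Fin n)} (h : Below d v u) :
    lowerSpan k d v ≤ lowerSpan k d u :=
  Submodule.span_mono (Set.image_mono fun _ h' => Below.trans h' h)

theorem wordCoeff_of_mem_lowerSpan {u v : List (Fin n)} (h : ¬ Below d v u)
    {y : FreeAlgebra k (Fin n)} (hy : y ∈ lowerSpan k d u) : wordCoeff k v y = 0 := by
  have : lowerSpan k d u ≤ LinearMap.ker (wordCoeff k v) := by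
    refine Submodule.span_le.2 ?_
    rintro _ ⟨z, hz, rfl⟩
    exact wordCoeff_of_ne (by rintro rfl; exact h hz)
  exact this hy

/-- A polynomial with leading term `v` is a combination of words preceding `u`, if `v` precedes `u`. -/
theorem mem_lowerSpan_of_sub {u v : List (Fin n)} (h : Below d v u) {y : FreeAlgebra k (Fin n)}
    (hy : y - monomial k v ∈ lowerSpan k d v) : y ∈ lowerSpan k d u := by
  simpa using add_mem (lowerSpan_mono h hy) (monomial_mem_lowerSpan h)

theorem lowerSpan_induction {u : List (Fin n)} {N : Submodule k (FreeAlgebra k (Fin n))}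
    (φ : FreeAlgebra k (Fin n) →ₗ[k] FreeAlgebra k (Fin n))
    (h : ∀ v, Below d v u → φ (monomial k v) ∈ N) {y : FreeAlgebra k (Fin n)}
    (hy : y ∈ lowerSpan k d u) : φ y ∈ N := by
  have : lowerSpan k d u ≤ N.comap φ := by
    refine Submodule.span_le.2 ?_
    rintro _ ⟨z, hz, rfl⟩
    exact h z hz
  exact this hy

/-- The span of the multiples `a F b` with `a w b` satisfying `P`. -/
def multiplesSpan (F : FreeAlgebra k (Fin n)) (w : List (Fin n)) (P : List (Fin n) → Prop) :
    Submodule k (FreeAlgebra k (Fin n)) :=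
  Submodule.span k {z | ∃ a b, P (a ++ w ++ b) ∧ z = monomial k a * F * monomial k b}

/-- Only finitely many multiples occur, and the greatest word among them bounds the rest. This bound
is what the well-founded descent lowers. -/
theorem exists_of_mem_multiplesSpan {F : FreeAlgebra k (Fin n)} {w : List (Fin n)}
    {P : List (Fin n) → Prop} {g : FreeAlgebra k (Fin n)} (hg : g ∈ multiplesSpan F w P) :
    g = 0 ∨ ∃ x, P x ∧ g ∈ multiplesSpan F w fun y => Below d y x ∨ y = x := by
  have mono : ∀ {x y : List (Fin n)}, Below d x y ∨ x = y →
      multiplesSpan F w (fun z => Below d z x ∨ z = x) ≤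
        multiplesSpan F w (fun z => Below d z y ∨ z = y) := by
    intro x y h
    refine Submodule.span_mono ?_
    rintro _ ⟨a, b, hab, rfl⟩
    refine ⟨a, b, ?_, rfl⟩
    rcases h with h | rfl
    · rcases hab with hab | hab
      · exact Or.inl (hab.trans h)
      · exact Or.inl (hab ▸ h)
    · exact hab
  refine Submodule.span_induction ?_ (Or.inl rfl) ?_ ?_ hg
  · rintro _ ⟨a, b, hab, rfl⟩
    exact Or.inr ⟨_, hab, Submodule.subset_span ⟨a, b, Or.inr rfl, rfl⟩⟩
  · rintro y z - - (rfl | ⟨s, hs, hy⟩) (rfl | ⟨t, ht, hz⟩)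
    · simp
    · exact Or.inr ⟨t, ht, by simpa⟩
    · exact Or.inr ⟨s, hs, by simpa⟩
    · rcases below_trichotomy (d := d) s t with h | h | h
      · exact Or.inr ⟨t, ht, add_mem (mono (Or.inl h) hy) hz⟩
      · exact Or.inr ⟨t, ht, add_mem (mono (Or.inr h) hy) hz⟩
      · exact Or.inr ⟨s, hs, add_mem hy (mono (Or.inl h) hz)⟩
  · rintro c y - (rfl | ⟨s, hs, hy⟩)
    · simp
    · exact Or.inr ⟨s, hs, Submodule.smul_mem _ _ hy⟩

variable [IsOrderedAddMonoid D]

theorem mul_mul_mem_lowerSpan (hd : ∀ i, 0 < d i) {u : List (Fin n)} {y : FreeAlgebra k (Fin n)}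
    (hy : y ∈ lowerSpan k d u) (a b : List (Fin n)) :
    monomial k a * y * monomial k b ∈ lowerSpan k d (a ++ u ++ b) := by
  refine lowerSpan_induction
    ((LinearMap.mulRight k (monomial k b)).comp (LinearMap.mulLeft k (monomial k a)))
    (fun v hv => ?_) hy
  simpa [monomial_append, mul_assoc] using
    monomial_mem_lowerSpan (k := k) (hv.append_append hd a b)

/-- Leading monomials multiply, by `yz - uv = (y - u)v + y(z - v)` and compatibility of the order
with products. -/
theorem mul_sub_monomial_mem (hd : ∀ i, 0 < d i) {u v : List (Fin n)}
    {y z : FreeAlgebra k (Fin n)} (hy : y - monomial k u ∈ lowerSpan k d u)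
    (hz : z - monomial k v ∈ lowerSpan k d v) :
    y * z - monomial k (u ++ v) ∈ lowerSpan k d (u ++ v) := by
  have h1 : (y - monomial k u) * monomial k v ∈ lowerSpan k d (u ++ v) := by
    simpa using mul_mul_mem_lowerSpan hd hy [] v
  have h2 : y * (z - monomial k v) ∈ lowerSpan k d (u ++ v) := by
    have h3 : monomial k u * (z - monomial k v) ∈ lowerSpan k d (u ++ v) := by
      simpa using mul_mul_mem_lowerSpan hd hz u []
    have h4 : (y - monomial k u) * (z - monomial k v) ∈ lowerSpan k d (u ++ v) := by
      refine lowerSpan_induction (LinearMap.mulRight k (z - monomial k v)) (fun u' hu' => ?_) hy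
      have h5 := mul_mul_mem_lowerSpan hd hz u' []
      have h6 : Below d (u' ++ v) (u ++ v) := by simpa using hu'.append_append hd [] v
      simp only [monomial_nil, mul_one, List.append_nil] at h5
      exact lowerSpan_mono h6 h5
    simpa [sub_mul] using add_mem h3 h4
  have := add_mem h1 h2
  rw [monomial_append]
  convert this using 1
  noncomm_ring

/-! ### Ideals generated by one element with a standard leading word -/

section Independence

variable {F : FreeAlgebra k (Fin n)} {w : List (Fin n)}

theorem multiple_sub_mem (hd : ∀ i, 0 < d i) (hF : F - monomial k w ∈ lowerSpan k d w)
    (a b : List (Fin n)) : monomial k a * F * monomial k b - monomial k (a ++ w ++ b) ∈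
      lowerSpan k d (a ++ w ++ b) := by
  have := mul_mul_mem_lowerSpan hd hF a b
  simpa [mul_sub, sub_mul, monomial_append, mul_assoc] using this

theorem multiplesSpan_below_le (hd : ∀ i, 0 < d i) (hF : F - monomial k w ∈ lowerSpan k d w)
    (x : List (Fin n)) : multiplesSpan F w (fun y => Below d y x) ≤ lowerSpan k d x := by
  refine Submodule.span_le.2 ?_
  rintro _ ⟨a, b, hab, rfl⟩
  exact mem_lowerSpan_of_sub hab (multiple_sub_mem hd hF a b)

/-- Multiples of `F` with the same leading word are congruent modulo lesser multiples, since `w`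
does not overlap with itself. -/
theorem multiple_sub_multiple_mem (hd : ∀ i, 0 < d i) (hw : IsStandardWord w)
    (hF : F - monomial k w ∈ lowerSpan k d w) {a b a' b' : List (Fin n)}
    (e : a ++ w ++ b = a' ++ w ++ b') :
    monomial k a * F * monomial k b - monomial k a' * F * monomial k b' ∈
      multiplesSpan F w (fun y => Below d y (a ++ w ++ b)) := by
  have key : ∀ {a b a' b' : List (Fin n)}, a ++ w ++ b = a' ++ w ++ b' → a.length ≤ a'.length →
      monomial k a * F * monomial k b - monomial k a' * F * monomial k b' ∈
        multiplesSpan F w (fun y => Below d y (a ++ w ++ b)) := by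
    intro a b a' b' e hl
    rcases hw.occurrences e hl with ⟨rfl, rfl⟩ | ⟨c, rfl, rfl⟩
    · simp
    · have h1 : monomial k (a ++ w ++ c) * F * monomial k b' -
          monomial k a * F * monomial k (c ++ w ++ b') = monomial k a * F * monomial k c *
            (F - monomial k w) * monomial k b' - monomial k a * (F - monomial k w) *
              monomial k c * F * monomial k b' := by
        simp only [monomial_append]; noncomm_ring
      rw [← neg_sub, h1, neg_sub]
      refine sub_mem ?_ ?_
      · refine lowerSpan_induction (N := multiplesSpan F w fun y =>
          Below d y (a ++ w ++ (c ++ w ++ b'))) ((LinearMap.mulRight k (monomial k b')).comp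
          ((LinearMap.mulRight k F).comp ((LinearMap.mulRight k (monomial k c)).comp
            (LinearMap.mulLeft k (monomial k a))))) (fun v hv => ?_) hF
        refine Submodule.subset_span ⟨a ++ v ++ c, b', ?_, by simp [monomial_append, mul_assoc]⟩
        simpa using hv.append_append hd a (c ++ w ++ b')
      · refine lowerSpan_induction (N := multiplesSpan F w fun y =>
          Below d y (a ++ w ++ (c ++ w ++ b'))) ((LinearMap.mulRight k (monomial k b')).comp
          (LinearMap.mulLeft k (monomial k a * F * monomial k c))) (fun v hv => ?_) hF
        refine Submodule.subset_span ⟨a, c ++ v ++ b', ?_, by simp [monomial_append, mul_assoc]⟩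
        simpa using hv.append_append hd (a ++ w ++ c) b'
  rcases le_total a.length a'.length with hl | hl
  · exact key e hl
  · rw [e, ← neg_sub]
    exact neg_mem (key e.symm hl)

/-- The leading word of an element of the ideal contains `w`. -/
theorem eq_zero_of_mem_multiplesSpan (hd : ∀ i, 0 < d i) (hw : IsStandardWord w)
    (hF : F - monomial k w ∈ lowerSpan k d w) {u : List (Fin n)} (hu : ¬ w <:+: u)
    {g : FreeAlgebra k (Fin n)} {c : k} (hg : g ∈ multiplesSpan F w fun _ => True)
    (h : g - c • monomial k u ∈ lowerSpan k d u) : c = 0 := by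
  have hlow : g ∈ lowerSpan k d u → c = 0 := by
    intro h'
    have := wordCoeff_of_mem_lowerSpan (not_below_self u) (sub_mem h' h)
    simpa [wordCoeff_self] using this
  have main : ∀ x, (g ∈ multiplesSpan F w fun y => Below d y x ∨ y = x) → c = 0 := by
    intro x
    -- Descent on a bound `x` for the leading words of the multiples that represent `g`.
    induction x using (wellFounded_below hd).induction with
    | _ x ih =>
    intro hgx
    have hbelow : (g ∈ multiplesSpan F w fun y => Below d y x) → c = 0 := by
      intro hg'
      rcases exists_of_mem_multiplesSpan (d := d) hg' with h0 | ⟨y, hy, hgy⟩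
      · exact hlow (by rw [h0]; exact zero_mem _)
      · exact ih y hy hgy
    by_cases hx : ∃ a b, a ++ w ++ b = x
    swap
    · refine hbelow (Submodule.span_mono ?_ hgx)
      rintro _ ⟨a, b, hab | hab, rfl⟩
      · exact ⟨a, b, hab, rfl⟩
      · exact absurd ⟨a, b, hab⟩ hx
    obtain ⟨a, b, rfl⟩ := hx
    -- All multiples at the top word are congruent, so a single one with coefficient `c'` remains.
    have hle : (multiplesSpan F w fun y => Below d y (a ++ w ++ b) ∨ y = a ++ w ++ b) ≤
        Submodule.span k {monomial k a * F * monomial k b} ⊔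
          multiplesSpan F w fun y => Below d y (a ++ w ++ b) := by
      refine Submodule.span_le.2 ?_
      rintro _ ⟨a', b', hab | hab, rfl⟩
      · exact Submodule.mem_sup_right (Submodule.subset_span ⟨a', b', hab, rfl⟩)
      · rw [← sub_add_cancel (monomial k a' * F * monomial k b') (monomial k a * F * monomial k b)]
        refine add_mem (Submodule.mem_sup_right ?_)
          (Submodule.mem_sup_left (Submodule.mem_span_singleton_self _))
        rw [← hab]
        exact multiple_sub_multiple_mem hd hw hF hab
    obtain ⟨y, hy, z, hz, hyz⟩ := Submodule.mem_sup.1 (hle hgx)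
    obtain ⟨c', rfl⟩ := Submodule.mem_span_singleton.1 hy
    have hzl := multiplesSpan_below_le hd hF _ hz
    -- A top word preceding `u` puts `g` below `u`; equality is excluded because `w` is not a factor
    -- of `u`; a top word after `u` does not occur in `g`, so `c' = 0` and the bound drops.
    rcases below_trichotomy (d := d) (a ++ w ++ b) u with hlt | heq | hgt
    · refine hlow ?_
      rw [← hyz]
      exact add_mem (Submodule.smul_mem _ _ (mem_lowerSpan_of_sub hlt (multiple_sub_mem hd hF a b)))
        (lowerSpan_mono hlt hzl)
    · exact absurd ⟨a, b, heq⟩ hu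
    · have h1 : wordCoeff k (a ++ w ++ b) g = c' := by
        have h2 := wordCoeff_of_mem_lowerSpan (not_below_self _) (multiple_sub_mem hd hF a b)
        rw [map_sub, wordCoeff_self, sub_eq_zero] at h2
        rw [← hyz, map_add, wordCoeff_of_mem_lowerSpan (not_below_self _) hzl, map_smul, h2]
        simp
      have h3 : wordCoeff k (a ++ w ++ b) g = 0 := by
        have h4 := wordCoeff_of_mem_lowerSpan (fun h' => not_below_self _ (hgt.trans h')) h
        rw [map_sub, map_smul, wordCoeff_of_ne, smul_zero, sub_zero] at h4
        · exact h4
        · rintro rfl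
          exact not_below_self _ hgt
      rw [← h1, h3, zero_smul, zero_add] at hyz
      exact hbelow (hyz ▸ hz)
  rcases exists_of_mem_multiplesSpan (d := d) hg with h0 | ⟨x, -, hx⟩
  · exact hlow (by rw [h0]; exact zero_mem _)
  · exact main x hx

end Independence

/-- The left ideal generated by all `F b` is the two-sided ideal of `F`; expanding both outer
factors in words gives multiples `a F b`. -/
theorem mem_multiplesSpan_of_mem_ideal {F : FreeAlgebra k (Fin n)} {w : List (Fin n)}
    {g : FreeAlgebra k (Fin n)}
    (hg : g ∈ Submodule.span (FreeAlgebra k (Fin n)) (Set.range fun b => F * b)) :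
    g ∈ multiplesSpan F w fun _ => True := by
  refine Submodule.span_induction ?_ (zero_mem _) (fun _ _ _ _ => add_mem) ?_ hg
  · rintro _ ⟨b, rfl⟩
    have : (⊤ : Submodule k (FreeAlgebra k (Fin n))) ≤
        (multiplesSpan F w fun _ => True).comap (LinearMap.mulLeft k F) := by
      rw [← span_monomial, Submodule.span_le]
      rintro _ ⟨u, rfl⟩
      exact Submodule.subset_span ⟨[], u, trivial, by simp⟩
    exact this (Submodule.mem_top (x := b))
  · intro a y _ hy
    have h1 : (⊤ : Submodule k (FreeAlgebra k (Fin n))) ≤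
        (multiplesSpan F w fun _ => True).comap (LinearMap.mulRight k y) := by
      rw [← span_monomial, Submodule.span_le]
      rintro _ ⟨u, rfl⟩
      have h2 : (multiplesSpan F w fun _ => True) ≤
          (multiplesSpan F w fun _ => True).comap (LinearMap.mulLeft k (monomial k u)) := by
        conv_lhs => rw [multiplesSpan]
        rw [Submodule.span_le]
        rintro _ ⟨a, b, -, rfl⟩
        exact Submodule.subset_span ⟨u ++ a, b, trivial, by simp [monomial_append, mul_assoc]⟩
      exact h2 hy
    exact h1 (Submodule.mem_top (x := a))

end FreeAlgebra
attribute [local instance] LieRing.ofAssociativeRing LieAlgebra.ofAssociativeAlgebra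

/-- `r` is a leading term of `f`. -/
def IsLeading {k : Type u} [Field k] {n : ℕ} {D : Type*} [AddCommGroup D] [LinearOrder D]
    (d : Fin n → D) (f : FreeMagma (Fin n) →₀ k) (r : FreeMagma (Fin n)) : Prop :=
  r ∈ f.support ∧ ∀ s ∈ f.support, s ≠ r → Below d (word s) (word r)

/-- Ties for the maximum are impossible, since a standard bracketing is determined by its word. -/
theorem exists_isLeading {k : Type u} [Field k] {n : ℕ} {D : Type*} [AddCommGroup D]
    [LinearOrder D] (d : Fin n → D) {f : FreeMagma (Fin n) →₀ k}
    (hf : ∀ t ∈ f.support, IsStandard t) (h0 : f.support.Nonempty) : ∃ r, IsLeading d f r := by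
  obtain ⟨r, hr, hmax⟩ := f.support.exists_max_image
    (fun s => toLex (degree d (word s), OrderDual.toDual (word s))) h0
  refine ⟨r, hr, fun s hs hne => ?_⟩
  have h := hmax s hs
  rw [Prod.Lex.toLex_le_toLex] at h
  refine h.imp id fun h => ⟨h.1, lt_of_le_of_ne (OrderDual.toDual_le_toDual.1 h.2) ?_⟩
  exact fun e => hne ((hf s hs).eq_of_word_eq (hf r hr) e.symm)

/-! ### Leading words of super-letters and the ideal of `f^*` -/

namespace QuantumVariables

variable {k : Type u} [Field k] {n : ℕ} {G : Type v} [CommGroup G] (Q : QuantumVariables k n G)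
  {D : Type*} [AddCommGroup D] [LinearOrder D] {d : Fin n → D}

theorem value_ι (t : FreeMagma (Fin n)) : Q.value (FreeAlgebra.ι k) t = Q.superLetter t := by
  have h : FreeAlgebra.lift k (FreeAlgebra.ι k) = AlgHom.id k (FreeAlgebra k (Fin n)) :=
    FreeAlgebra.hom_ext (by ext; simp)
  rw [value, h, AlgHom.id_apply]

section Leading

variable [IsOrderedAddMonoid D]

/-- The leading word of a super-letter. -/
theorem superLetter_sub_mem (hd : ∀ i, 0 < d i) {t : FreeMagma (Fin n)} (ht : IsStandard t) :
    Q.superLetter t - monomial k (word t) ∈ lowerSpan k d (word t) := by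
  induction t using FreeMagma.rec with
  | of i => simp [superLetter, monomial, word]
  | mul a b iha ihb =>
    have h1 := mul_sub_monomial_mem hd (iha ht.1) (ihb ht.2.1)
    have h2 := mul_sub_monomial_mem hd (ihb ht.2.1) (iha ht.1)
    -- Standardness of `ab` says precisely that `ba` is lesser, so the second term of the commutator
    -- does not reach the leading word.
    have hlt : Below d (word b ++ word a) (word a ++ word b) :=
      Or.inr ⟨by simp [degree_append, add_comm],
        ht.isStandardWord.2 (word a) (word b) (word_ne_nil a) (word_ne_nil b) rfl⟩
    have h3 := sub_mem h1 (Submodule.smul_mem _ (Q.p (word a) (word b) : k)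
      (mem_lowerSpan_of_sub hlt h2))
    rw [sub_right_comm] at h3
    exact h3

/-- The leading word of a super-word. -/
theorem superWordValue_sub_mem (hd : ∀ i, 0 < d i) {l : List (FreeMagma (Fin n))}
    (hl : ∀ s ∈ l, IsStandard s) :
    Q.superWordValue (FreeAlgebra.ι k) l - monomial k (l.flatMap word) ∈
      lowerSpan k d (l.flatMap word) := by
  induction l with
  | nil => simp
  | cons s l ih =>
    rw [superWordValue_cons, value_ι, List.flatMap_cons]
    exact mul_sub_monomial_mem hd (Q.superLetter_sub_mem hd (hl s (by simp)))
      (ih fun r hr => hl r (by simp [hr]))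

end Leading

/-- A super-word in super-letters less than `u` of the same degree precedes `u`. -/
theorem below_of_forall_lt [IsOrderedAddMonoid D] (hd : ∀ i, 0 < d i) {u : List (Fin n)}
    (hu : u ≠ []) {l : List (FreeMagma (Fin n))} (hl : ∀ s ∈ l, u < word s)
    (h : degree d (l.flatMap word) = degree d u) : Below d (l.flatMap word) u := by
  refine Or.inr ⟨h, ?_⟩
  cases l with
  | nil =>
    have := degree_pos hd hu
    rw [← h] at this
    simp [degree] at this
  | cons s l =>
    have hs := hl s (by simp)
    have hp := not_prefix_of_degree_le hd hs ((degree_le_of_mem hd (by simp)).trans h.le)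
    change u < _
    rw [List.flatMap_cons]
    exact hs.trans_le (le_append_self _ _)

variable (f : FreeMagma (Fin n) →₀ k) (hom : Q.IsHomogeneous f)

/-- Left multiplication on the quotient by `J` kills `f^*`, so it factors through the algebra with
relation `f^* = 0`. Thus `g` acts as zero, and its action on the class of `1` shows that it lies in
`J`. -/
theorem mem_ideal_of_mk_eq_zero {g : FreeAlgebra k (Fin n)} (hg : BraidedEnv.mk Q f hom g = 0) :
    g ∈ Submodule.span (FreeAlgebra k (Fin n)) (Set.range fun b => Q.star f * b) := by
  set J := Submodule.span (FreeAlgebra k (Fin n)) (Set.range fun b => Q.star f * b) with hJ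
  let φ : FreeAlgebra k (Fin n) →ₐ[k] Module.End k (FreeAlgebra k (Fin n) ⧸ J) :=
    Algebra.lsmul k k (FreeAlgebra k (Fin n) ⧸ J)
  have hφ : φ (Q.star f) = 0 := by
    refine LinearMap.ext fun y => ?_
    obtain ⟨y, rfl⟩ := Submodule.Quotient.mk_surjective J y
    change Q.star f • (Submodule.Quotient.mk y : FreeAlgebra k (Fin n) ⧸ J) = 0
    rw [← Submodule.Quotient.mk_smul, Submodule.Quotient.mk_eq_zero]
    exact Submodule.subset_span ⟨y, rfl⟩
  have hrel : ∀ ⦃a b : FreeAlgebra k (Fin n)⦄, (a = Q.star f ∧ b = 0) → φ a = φ b := by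
    rintro a b ⟨rfl, rfl⟩
    rw [hφ, map_zero]
  have h1 : φ g = 0 := by
    have h2 := RingQuot.liftAlgHom_mkAlgHom_apply k φ hrel g
    rw [← h2]
    have h3 : RingQuot.mkAlgHom k (fun a b : FreeAlgebra k (Fin n) => a = Q.star f ∧ b = 0) g = 0 :=
      hg
    rw [h3, map_zero]
  have h4 : φ g (Submodule.Quotient.mk 1) = 0 := by rw [h1]; rfl
  change g • (Submodule.Quotient.mk 1 : FreeAlgebra k (Fin n) ⧸ J) = 0 at h4
  rw [← Submodule.Quotient.mk_smul, Submodule.Quotient.mk_eq_zero] at h4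
  simpa using h4

variable {f}

/-- A super-letter that is congruent to a combination of preceding words modulo `f^*` contains the
leading word of `f`. -/
theorem exists_infix_of_mk_eq [IsOrderedAddMonoid D] (hd : ∀ i, 0 < d i)
    (hf : ∀ t ∈ f.support, IsStandard t) {t : FreeMagma (Fin n)} (ht : IsStandard t)
    {y : FreeAlgebra k (Fin n)} (hy : y ∈ lowerSpan k d (word t))
    (h : BraidedEnv.mk Q f hom (Q.superLetter t) = BraidedEnv.mk Q f hom y) :
    ∃ r, IsLeading d f r ∧ word r <:+: word t := by
  have hg := Q.mem_ideal_of_mk_eq_zero f hom (g := Q.superLetter t - y) (by rw [map_sub, h, sub_self])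
  have hlow : Q.superLetter t - y - (1 : k) • monomial k (word t) ∈ lowerSpan k d (word t) := by
    rw [one_smul, sub_right_comm]
    exact sub_mem (Q.superLetter_sub_mem hd ht) hy
  rcases f.support.eq_empty_or_nonempty with h0 | h0
  · rw [Finsupp.support_eq_empty] at h0
    have hstar : Q.star f = 0 := by simp [star, h0]
    simp only [hstar, zero_mul, Set.range_const, Submodule.span_zero_singleton,
      Submodule.mem_bot] at hg
    rw [hg, zero_sub] at hlow
    have := wordCoeff_of_mem_lowerSpan (not_below_self _) hlow
    rw [map_neg, map_smul, wordCoeff_self] at this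
    simp at this
  obtain ⟨r, hr⟩ := exists_isLeading d hf h0
  refine ⟨r, hr, ?_⟩
  by_contra hrt
  have hr0 : f r ≠ 0 := Finsupp.mem_support_iff.1 hr.1
  have hstar : Q.star f = f r • Q.superLetter r + ∑ s ∈ f.support.erase r, f s • Q.superLetter s := by
    rw [Finset.add_sum_erase _ (fun s => f s • Q.superLetter s) hr.1]; rfl
  -- After normalization `f^*` is monic with leading word that of `r`, as the other terms have
  -- preceding leading words.
  have hF : (f r)⁻¹ • Q.star f - monomial k (word r) ∈ lowerSpan k d (word r) := by
    rw [hstar, smul_add, smul_smul, inv_mul_cancel₀ hr0, one_smul, add_sub_right_comm]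
    refine add_mem (Q.superLetter_sub_mem hd (hf r hr.1)) (Submodule.smul_mem _ _ (sum_mem ?_))
    intro s hs
    rw [Finset.mem_erase] at hs
    exact Submodule.smul_mem _ _
      (mem_lowerSpan_of_sub (hr.2 s hs.2 hs.1) (Q.superLetter_sub_mem hd (hf s hs.2)))
  have hg' : Q.superLetter t - y ∈ Submodule.span (FreeAlgebra k (Fin n))
      (Set.range fun b => ((f r)⁻¹ • Q.star f) * b) := by
    refine Submodule.span_mono ?_ hg
    rintro _ ⟨b, rfl⟩
    exact ⟨f r • b, by simp [smul_smul, mul_inv_cancel₀ hr0]⟩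
  exact one_ne_zero (eq_zero_of_mem_multiplesSpan hd (hf r hr.1).isStandardWord hF hrt
    (mem_multiplesSpan_of_mem_ideal hg') hlow)

/-! ### Hard super-letters -/

variable (f)

/-- The embedding of `U_P^b` into `U_P`. -/
noncomputable def BraidedEnv.toQuantumEnv : Q.BraidedEnv f hom →ₐ[k] Q.QuantumEnv f hom :=
  AlgHom.mk' SkewMonoidAlgebra.singleOneRingHom fun c a =>
    (SkewMonoidAlgebra.smul_single c (1 : G) a).symm

theorem BraidedEnv.toQuantumEnv_apply (a : Q.BraidedEnv f hom) :
    BraidedEnv.toQuantumEnv Q f hom a = SkewMonoidAlgebra.single 1 a := rfl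

theorem lift_gen (F : FreeAlgebra k (Fin n)) : FreeAlgebra.lift k (QuantumEnv.gen Q f hom) F =
    BraidedEnv.toQuantumEnv Q f hom (BraidedEnv.mk Q f hom F) := by
  have h : FreeAlgebra.lift k (QuantumEnv.gen Q f hom) =
      (BraidedEnv.toQuantumEnv Q f hom).comp (BraidedEnv.mk Q f hom) :=
    FreeAlgebra.hom_ext (by ext i; simp [QuantumEnv.gen, BraidedEnv.toQuantumEnv_apply])
  rw [h, AlgHom.comp_apply]

theorem superWordValue_gen (l : List (FreeMagma (Fin n))) :
    Q.superWordValue (QuantumEnv.gen Q f hom) l = BraidedEnv.toQuantumEnv Q f hom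
      (BraidedEnv.mk Q f hom (Q.superWordValue (FreeAlgebra.ι k) l)) := by
  induction l with
  | nil => simp
  | cons s l ih =>
    rw [superWordValue_cons, superWordValue_cons, map_mul, map_mul, ih, value_ι, value, lift_gen]

/-- The component of the unit of `G`. -/
noncomputable def QuantumEnv.coeffOne : Q.QuantumEnv f hom →ₗ[k] Q.BraidedEnv f hom where
  toFun z := z.coeff 1
  map_add' y z := by simp
  map_smul' c z := by simp

theorem QuantumEnv.coeffOne_toQuantumEnv (a : Q.BraidedEnv f hom) :
    QuantumEnv.coeffOne Q f hom (BraidedEnv.toQuantumEnv Q f hom a) = a := by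
  simp [coeffOne, BraidedEnv.toQuantumEnv_apply]

theorem QuantumEnv.coeffOne_ofGroup_mul (x : G) (a : Q.BraidedEnv f hom) :
    QuantumEnv.coeffOne Q f hom
      (QuantumEnv.ofGroup Q f hom x * BraidedEnv.toQuantumEnv Q f hom a) = 0 ∨
    QuantumEnv.coeffOne Q f hom
      (QuantumEnv.ofGroup Q f hom x * BraidedEnv.toQuantumEnv Q f hom a) = a := by
  by_cases hx : x = 1
  · right
    rw [hx, map_one, one_mul, coeffOne_toQuantumEnv]
  · left
    simp [coeffOne, ofGroup, BraidedEnv.toQuantumEnv_apply, SkewMonoidAlgebra.of_apply,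
      SkewMonoidAlgebra.single_mul_single, hx]

variable {f}

/-- The hard super-letters are those whose words do not contain the leading word of `f`. Only the
homogeneity of `f^*` is needed: standard words have no self-overlaps, so `f^*` alone is a Gröbner
basis of the ideal that it generates. -/
theorem mem_hardWords_iff [IsOrderedAddMonoid D] (hd : ∀ i, 0 < d i)
    (hf : ∀ t ∈ f.support, IsStandard t) (t : FreeMagma (Fin n)) :
    t ∈ Q.hardWords d f hom ↔
      IsStandard t ∧ ¬ ∃ r, IsLeading d f r ∧ word r <:+: word t := by
  refine and_congr_right fun ht => ⟨?_, fun hno hmem => hno ?_⟩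
  · rintro hard ⟨r, hr, hrt⟩
    refine hard ?_
    have hx : FreeAlgebra.lift k (QuantumEnv.gen Q f hom) (Q.star f) = 0 := by
      rw [lift_gen, BraidedEnv.mk_star, map_zero]
    refine Submodule.span_mono ?_ (value_mem_of_infix hd hf hom hx hr.1 hr.2 ht hrt)
    rintro _ ⟨l, ⟨hl, h | ⟨h1, h2, -⟩⟩, rfl⟩
    · exact Or.inr ⟨1, l, hl, by rwa [← degree_flatMap_word], by simp⟩
    · exact Or.inl ⟨l, fun s hs => ⟨hl s hs, h1 s hs⟩, by rwa [← degree_flatMap_word], rfl⟩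
  -- The component of the unit fixes super-words and sends each `G`-super-word to zero or to its
  -- super-word. A dependence in the skew group algebra thus becomes a congruence modulo `f^*` with
  -- words preceding that of `t`.
  · have h1 : Q.value (QuantumEnv.gen Q f hom) t ∈ ((lowerSpan k d (word t)).map
        (BraidedEnv.mk Q f hom).toLinearMap).comap (QuantumEnv.coeffOne Q f hom) := by
      refine Submodule.span_le.2 (Set.union_subset ?_ ?_) hmem
      · rintro _ ⟨l, hl, hD, rfl⟩
        rw [← degree_flatMap_word] at hD
        rw [SetLike.mem_coe, Submodule.mem_comap]
        rw [superWordValue_gen, QuantumEnv.coeffOne_toQuantumEnv]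
        refine Submodule.mem_map_of_mem (f := (BraidedEnv.mk Q f hom).toLinearMap) ?_
        exact mem_lowerSpan_of_sub
          (below_of_forall_lt hd (word_ne_nil t) (fun s hs => (hl s hs).2) hD)
          (Q.superWordValue_sub_mem hd fun s hs => (hl s hs).1)
      · rintro _ ⟨x, l, hl, hD, rfl⟩
        rw [← degree_flatMap_word] at hD
        rw [SetLike.mem_coe, Submodule.mem_comap]
        rw [superWordValue_gen]
        rcases QuantumEnv.coeffOne_ofGroup_mul Q f hom x
          (BraidedEnv.mk Q f hom (Q.superWordValue (FreeAlgebra.ι k) l)) with h | h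
        · rw [h]; exact zero_mem _
        · rw [h]
          exact Submodule.mem_map_of_mem (f := (BraidedEnv.mk Q f hom).toLinearMap)
            (mem_lowerSpan_of_sub (Or.inl hD) (Q.superWordValue_sub_mem hd hl))
    rw [Submodule.mem_comap, value, lift_gen, QuantumEnv.coeffOne_toQuantumEnv] at h1
    obtain ⟨y, hy, e⟩ := h1
    exact Q.exists_infix_of_mk_eq hom hd hf ht hy e.symm

end QuantumVariables

/-! ### The Hall–Shirshov basis -/

section Lie

variable {k : Type u} [Field k] {n : ℕ} {D : Type*} [AddCommGroup D] [LinearOrder D]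
  {d : Fin n → D} {f : FreeMagma (Fin n) →₀ k}

theorem lieValue_gen (t : FreeMagma (Fin n)) : lieValue (OneRelatorLie.gen f) t =
    LieSubmodule.Quotient.mk (lieValue (FreeLieAlgebra.of k) t) := by
  induction t using FreeMagma.rec with
  | of i => rfl
  | mul a b iha ihb =>
    change ⁅lieValue _ a, lieValue _ b⁆ = _
    rw [iha, ihb, ← LieSubmodule.Quotient.mk_bracket]
    rfl

theorem sum_lieValue_gen : f.sum (fun t c => c • lieValue (OneRelatorLie.gen f) t) = 0 := by
  have h : LieSubmodule.Quotient.mk' (LieSubmodule.lieSpan k (FreeLieAlgebra k (Fin n))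
      {lieRelator f}) (lieRelator f) = 0 :=
    (LieSubmodule.Quotient.mk_eq_zero _).2 (LieSubmodule.subset_lieSpan rfl)
  refine Eq.trans ?_ h
  refine Eq.trans ?_ (map_sum (LieSubmodule.Quotient.mk' (LieSubmodule.lieSpan k
    (FreeLieAlgebra k (Fin n)) {lieRelator f}))
    (fun t => f t • lieValue (FreeLieAlgebra.of k) t) f.support).symm
  refine Finset.sum_congr rfl fun t _ => ?_
  rw [map_smul]
  exact congrArg (f t • ·) (lieValue_gen t)

variable (k n) in
/-- Quantum variables with a trivial group. -/
def trivialVariables : QuantumVariables k n PUnit.{1} := ⟨1, 1⟩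

theorem trivialVariables_p (u v : List (Fin n)) : (trivialVariables k n).p u v = 1 := by
  rw [QuantumVariables.p, Subsingleton.elim ((trivialVariables k n).gr v) 1,
    QuantumVariables.chr_apply_one]

theorem trivialVariables_isHomogeneous : (trivialVariables k n).IsHomogeneous f := fun s _ t _ =>
  ⟨Subsingleton.elim _ _, funext fun x => by
    rw [Subsingleton.elim x 1, QuantumVariables.chr_apply_one, QuantumVariables.chr_apply_one]⟩

/-- With all `p_ij = 1` the skew commutator is the ordinary one, so the leading-word results for
super-letters apply to Lie elements. Only the homomorphism is needed, not its injectivity. -/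
theorem lift_lieValue (t : FreeMagma (Fin n)) :
    FreeLieAlgebra.lift k (FreeAlgebra.ι k) (lieValue (FreeLieAlgebra.of k) t) =
      (trivialVariables k n).superLetter t := by
  induction t using FreeMagma.rec with
  | of i => simp [lieValue, QuantumVariables.superLetter]
  | mul a b iha ihb =>
    simp [lieValue, QuantumVariables.superLetter, iha, ihb, trivialVariables_p,
      LieRing.of_associative_ring_bracket]

/-- The Hall–Shirshov basis consists of the standard words that do not contain the leading word
of `f`. -/
theorem mem_hallShirshovBasis_iff [IsOrderedAddMonoid D] (hd : ∀ i, 0 < d i)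
    (hf : ∀ t ∈ f.support, IsStandard t) (t : FreeMagma (Fin n)) :
    t ∈ hallShirshovBasis k d (OneRelatorLie.gen f) ↔
      IsStandard t ∧ ¬ ∃ r, IsLeading d f r ∧ word r <:+: word t := by
  refine and_congr_right fun ht => ⟨?_, fun hno hmem => hno ?_⟩
  · rintro hnot ⟨r, hr, hrt⟩
    refine hnot ?_
    refine Submodule.span_mono ?_
      (lieValue_mem_of_infix hd hf sum_lieValue_gen hr.1 hr.2 ht hrt)
    rintro _ ⟨s, hs, rfl⟩
    exact ⟨s, hs.1, hs.2, rfl⟩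
  · set Q := trivialVariables k n with hQ
    have hom : Q.IsHomogeneous f := trivialVariables_isHomogeneous
    let M := (lieSpanOf k (FreeLieAlgebra.of k) {s | IsStandard s ∧ Below d (word s) (word t)})
    have hle : Submodule.span k {z | ∃ s, IsStandard s ∧ Below d (word s) (word t) ∧
        z = lieValue (OneRelatorLie.gen f) s} ≤ M.map (LieSubmodule.Quotient.mk'
          (LieSubmodule.lieSpan k (FreeLieAlgebra k (Fin n)) {lieRelator f}) : _ →ₗ[k] _) := by
      refine Submodule.span_le.2 ?_
      rintro _ ⟨s, hs, hst, rfl⟩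
      rw [lieValue_gen]
      exact Submodule.mem_map_of_mem (lieValue_mem (k := k) (x := FreeLieAlgebra.of k)
        (E := {s | IsStandard s ∧ Below d (word s) (word t)}) ⟨hs, hst⟩)
    obtain ⟨y, hy, e⟩ := hle hmem
    rw [lieValue_gen] at e
    have hI : lieValue (FreeLieAlgebra.of k) t - y ∈
        LieSubmodule.lieSpan k (FreeLieAlgebra k (Fin n)) {lieRelator f} := by
      rw [← LieSubmodule.Quotient.mk_eq_zero, map_sub, sub_eq_zero]
      exact e.symm
    let ψ : FreeLieAlgebra k (Fin n) →ₗ⁅k⁆ Q.BraidedEnv f hom :=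
      ((QuantumVariables.BraidedEnv.mk Q f hom : _ →ₐ[k] _) : _ →ₗ⁅k⁆ _).comp
        (FreeLieAlgebra.lift k (FreeAlgebra.ι k))
    have hψ : ∀ z, ψ z = QuantumVariables.BraidedEnv.mk Q f hom
      (FreeLieAlgebra.lift k (FreeAlgebra.ι k) z) := fun _ => rfl
    -- The relator maps to `f^*`, which vanishes in the quotient, so the whole Lie ideal is killed
    -- and a dependence in the Lie algebra carries over.
    have hker : LieSubmodule.lieSpan k (FreeLieAlgebra k (Fin n)) {lieRelator f} ≤ ψ.ker := by
      rw [LieSubmodule.lieSpan_le, Set.singleton_subset_iff]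
      change lieRelator f ∈ ψ.ker
      rw [LieHom.mem_ker, hψ, ← QuantumVariables.BraidedEnv.mk_star Q f hom]
      congr 1
      rw [lieRelator, QuantumVariables.star, Finsupp.sum, Finsupp.sum, map_sum]
      exact Finset.sum_congr rfl fun s _ => by rw [map_smul, lift_lieValue]
    have h1 := LieHom.mem_ker.1 (hker hI)
    rw [map_sub, sub_eq_zero, hψ, hψ, lift_lieValue] at h1
    refine Q.exists_infix_of_mk_eq hom hd hf ht ?_ h1
    have hM : M ≤ (lowerSpan k d (word t)).comap
        (FreeLieAlgebra.lift k (FreeAlgebra.ι k) : _ →ₗ⁅k⁆ _).toLinearMap := by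
      refine Submodule.span_le.2 ?_
      rintro _ ⟨s, hs, rfl⟩
      change FreeLieAlgebra.lift k (FreeAlgebra.ι k) (lieValue (FreeLieAlgebra.of k) s) ∈
        lowerSpan k d (word t)
      rw [lift_lieValue]
      exact mem_lowerSpan_of_sub hs.2 (Q.superLetter_sub_mem hd hs.1)
    exact hM hy

end Lie

end SuperLetters

open SuperLetters in
theorem corollary8p1 {k : Type*} [Field k] {n : ℕ}
    {D : Type*} [AddCommGroup D] [LinearOrder D] [IsOrderedAddMonoid D]
    (d : Fin n → D) (hd : ∀ i, 0 < d i)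
    (f : FreeMagma (Fin n) →₀ k) (hf : ∀ t ∈ f.support, IsStandard t)
    {G : Type*} [CommGroup G] (Q : QuantumVariables k n G) (hQ : Q.Quantifies f)
    {G' : Type*} [CommGroup G'] (Q' : QuantumVariables k n G') (hQ' : Q'.Quantifies f) :
    Q.hardSuperLetters d f hQ.homogeneous =
        Q.superLetter '' hallShirshovBasis k d (OneRelatorLie.gen f) ∧
      Q.hardWords d f hQ.homogeneous = hallShirshovBasis k d (OneRelatorLie.gen f) ∧
      Q.hardWords d f hQ.homogeneous = Q'.hardWords d f hQ'.homogeneous := by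
  have h : Q.hardWords d f hQ.homogeneous = hallShirshovBasis k d (OneRelatorLie.gen f) :=
    Set.ext fun t =>
      (Q.mem_hardWords_iff hQ.homogeneous hd hf t).trans (mem_hallShirshovBasis_iff hd hf t).symm
  have h' : Q'.hardWords d f hQ'.homogeneous = hallShirshovBasis k d (OneRelatorLie.gen f) :=
    Set.ext fun t =>
      (Q'.mem_hardWords_iff hQ'.homogeneous hd hf t).trans (mem_hallShirshovBasis_iff hd hf t).symm
  refine ⟨?_, h, h.trans h'.symm⟩
  rw [← h]
  ext P
  constructor
  · rintro ⟨t, ht, rfl, hard⟩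
    exact ⟨t, ⟨ht, hard⟩, rfl⟩
  · rintro ⟨t, ⟨ht, hard⟩, rfl⟩
    exact ⟨t, ht, rfl, hard⟩
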